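/- Let $\mathcal H$ be a separable infinite-dimensional real Hilbert space, let $B$ be a bounded self-adjoint operator on $\mathcal H$ with $\langle Bx,x\rangle>0$ for all $x\ne 0$, and let $\mu_B$ be a Borel probability measure on $\mathcal H$ with characteristic functional $\int_{\mathcal H} e^{i\langle x,y\rangle}\,d\mu_B(x)=e^{-\frac12\langle By,y\rangle}$, $y\in\mathcal H$ (the centred Gaussian measure with covariance operator $B$; such a $B$ is automatically nuclear). Let $\mathcal H_0:=B^{1/2}\mathcal H$ with the norm $\|x\|_0:=\|B^{-1/2}x\|$, and let $L_f x:=x+f$. For a group $\Gamma$ of $\nu$-nonsingular transformations of a probability space $(Y,\nu)$ put $\rho_\nu(\gamma,y):=\log\frac{d(\nu\circ\gamma)}{d\nu}(y)$. The group $\Gamma$ is of Krieger type $III_1$ if it is ergodic and its Maharam extension, i.e. the group of transformations $(y,t)\mapsto(\gamma y,\rho_\nu(\gamma,y)+t)$, $\gamma\in\Gamma$, of $Y\times\mathbb R$, is ergodic for the product of $\nu$ and Lebesgue measure (ergodic: every measurable set which is invariant mod 0 under each transformation of the group is null or conull). A number $a\in\mathbb R$ is an essential value of $\rho_\nu$ if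 for each measurable $A\subset Y$ with $\nu(A)>0$ and each neighbourhood $U$ of $a$ there are a measurable $D\subset A$ with $\nu(D)>0$ and $\gamma\in\Gamma$ such that $\gamma D\subset A$ and $\rho_\nu(\gamma,y)\in U$ for all $y\in D$. **Theorem.** The group $\{L_f : f\in\mathcal H_0\}$ acts on $(\mathcal H,\mu_B)$ by nonsingular transformations and is of Krieger type $III_1$. More precisely, countable subgroups of $\mathcal H_0$ that are dense in $(\mathcal H_0,\|\cdot\|_0)$ exist, and for every such subgroup $G$ the countable group $\{L_f: f\in G\}$ is of Krieger type $III_1$. Moreover, for every orthonormal basis $(e_k)_{k\in\mathbb N}$ of $\mathcal H$ consisting of eigenvectors of $B$, $Be_k=\lambda_ke_k$, all the vectors $\sqrt{\lambda_k}\,e_k$ lie in $\mathcal H_0$, and every real number is an essential value of the logarithm of the Radon–Nikodym cocycle of the countable group generated by the translations $L_{\sqrt{\lambda_k}e_k}$, $k\in\mathbb N$. -/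

import Mathlib

open MeasureTheory

noncomputable section

namespace GaussianTranslations

/-! ### Nonsingular transformation groups, Radon-Nikodym cocycle, Krieger type `III₁`

Throughout, a set `Γ` of bi-measurable bijections of `Y` plays the role of a transformation group;
it is applied below to sets of translations indexed by an additive subgroup. -/

section Krieger

variable {Y : Type*} [MeasurableSpace Y]

/-- `γ` is `ν`-nonsingular: the image measure of `ν` is equivalent to `ν`. -/
def Nonsingular (ν : Measure Y) (γ : Y ≃ᵐ Y) : Prop :=
  ν.map γ ≪ ν ∧ ν ≪ ν.map γ

/-- The logarithm of the Radon-Nikodym cocycle, `log (d(ν ∘ γ)/dν) (y)`. Here `ν ∘ γ` is the measure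
`A ↦ ν (γ A)`, that is, the image of `ν` under `γ⁻¹`. -/
def rnCocycle (ν : Measure Y) (γ : Y ≃ᵐ Y) (y : Y) : ℝ :=
  Real.log ((ν.map γ.symm).rnDeriv ν y).toReal

/-- A family of self-maps is ergodic for `ν` if each measurable set that is invariant modulo
`ν`-null sets under each of the maps is null or conull. -/
def ErgodicFamily {Z : Type*} [MeasurableSpace Z] (ν : Measure Z) (F : Set (Z → Z)) : Prop :=
  ∀ A : Set Z, MeasurableSet A → (∀ f ∈ F, f ⁻¹' A =ᵐ[ν] A) → ν A = 0 ∨ ν Aᶜ = 0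

/-- The skew product map `(y, t) ↦ (γ y, ρ(γ, y) + t)` for `ρ` the logarithm of the
Radon-Nikodym cocycle. -/
def maharamMap (ν : Measure Y) (γ : Y ≃ᵐ Y) (p : Y × ℝ) : Y × ℝ :=
  (γ p.1, rnCocycle ν γ p.1 + p.2)

/-- `Γ` is of Krieger type `III₁`: it is nonsingular and ergodic, and its Maharam extension is
ergodic. The extension preserves `ν ⊗ e⁻ᵗ dt`, which has the same null sets as `ν ⊗ dt`; ergodicity
depends on the null sets only. -/
structure IsKriegerTypeIIIOne (ν : Measure Y) (Γ : Set (Y ≃ᵐ Y)) : Prop where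
  nonsingular : ∀ γ ∈ Γ, Nonsingular ν γ
  ergodic : ErgodicFamily ν ((fun γ : Y ≃ᵐ Y => (γ : Y → Y)) '' Γ)
  maharam_ergodic : ErgodicFamily (ν.prod (volume : Measure ℝ)) (maharamMap ν '' Γ)

/-- `a` is an essential value of the (logarithm of the) Radon-Nikodym cocycle of `Γ`: for each
measurable `A` with `ν A > 0` and each neighbourhood `U` of `a` there are a measurable `D ⊆ A` with
`ν D > 0` and `γ ∈ Γ` such that `γ D ⊆ A` and `ρ(γ, y) ∈ U` for all `y ∈ D`. -/
def IsEssentialValue (ν : Measure Y) (Γ : Set (Y ≃ᵐ Y)) (a : ℝ) : Prop :=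
  ∀ A : Set Y, MeasurableSet A → 0 < ν A → ∀ U ∈ nhds a,
    ∃ D ⊆ A, MeasurableSet D ∧ 0 < ν D ∧
      ∃ γ ∈ Γ, γ '' D ⊆ A ∧ ∀ y ∈ D, rnCocycle ν γ y ∈ U

end Krieger

/-! ### Positive square roots -/

section Sqrt

variable {H : Type*} [NormedAddCommGroup H] [InnerProductSpace ℝ H]

/-- Polynomials `p₀ = 0`, `pₙ₊₁ = (x + pₙ²) / 2`, converging to `1 - √(1 - x)`; used only to prove
that positive operators have positive square roots. -/
def sqrtPoly : ℕ → Polynomial ℝ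
  | 0 => 0
  | n + 1 => Polynomial.C (1 / 2) * (Polynomial.X + sqrtPoly n ^ 2)

/-- All coefficients are nonnegative. -/
def NonnegCoeff (p : Polynomial ℝ) : Prop := ∀ k, 0 ≤ p.coeff k

theorem NonnegCoeff.mul {p q : Polynomial ℝ} (hp : NonnegCoeff p) (hq : NonnegCoeff q) :
    NonnegCoeff (p * q) := fun k => by
  rw [Polynomial.coeff_mul]
  exact Finset.sum_nonneg fun i _ => mul_nonneg (hp _) (hq _)

theorem NonnegCoeff.add {p q : Polynomial ℝ} (hp : NonnegCoeff p) (hq : NonnegCoeff q) :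
    NonnegCoeff (p + q) := fun k => by
  rw [Polynomial.coeff_add]
  exact add_nonneg (hp _) (hq _)

theorem nonnegCoeff_half : NonnegCoeff (Polynomial.C (1 / 2)) := fun k => by
  rw [Polynomial.coeff_C]; split_ifs <;> norm_num

theorem nonnegCoeff_sqrtPoly (n : ℕ) : NonnegCoeff (sqrtPoly n) := by
  induction n with
  | zero => intro k; simp [sqrtPoly]
  | succ n ih =>
    refine nonnegCoeff_half.mul (NonnegCoeff.add ?_ ?_)
    · intro k; rw [Polynomial.coeff_X]; split_ifs <;> norm_num
    · rw [pow_two]; exact ih.mul ih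

theorem nonnegCoeff_sqrtPoly_succ_sub (n : ℕ) :
    NonnegCoeff (sqrtPoly (n + 1) - sqrtPoly n) := by
  induction n with
  | zero => simpa [sqrtPoly] using nonnegCoeff_sqrtPoly 1
  | succ n ih =>
    have h : sqrtPoly (n + 1 + 1) - sqrtPoly (n + 1) = Polynomial.C (1 / 2) *
        ((sqrtPoly (n + 1) - sqrtPoly n) * (sqrtPoly (n + 1) + sqrtPoly n)) := by
      change Polynomial.C (1 / 2) * (Polynomial.X + sqrtPoly (n + 1) ^ 2) -
        Polynomial.C (1 / 2) * (Polynomial.X + sqrtPoly n ^ 2) = _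
      ring
    rw [h]
    exact nonnegCoeff_half.mul
      (ih.mul ((nonnegCoeff_sqrtPoly (n + 1)).add (nonnegCoeff_sqrtPoly n)))

theorem sqrtPoly_eval_one_le (n : ℕ) : (sqrtPoly n).eval 1 ≤ 1 := by
  have h0 : ∀ m, 0 ≤ (sqrtPoly m).eval 1 := fun m => by
    rw [Polynomial.eval_eq_sum_range]
    exact Finset.sum_nonneg fun i _ => by simpa using nonnegCoeff_sqrtPoly m i
  induction n with
  | zero => simp [sqrtPoly]
  | succ n ih =>
    have := h0 n
    simp only [sqrtPoly, Polynomial.eval_mul, Polynomial.eval_C, Polynomial.eval_add,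
      Polynomial.eval_X, Polynomial.eval_pow]
    nlinarith

theorem norm_aeval_le {X : H →L[ℝ] H} (hX : ‖X‖ ≤ 1) {p : Polynomial ℝ} (hp : NonnegCoeff p) :
    ‖Polynomial.aeval X p‖ ≤ p.eval 1 := by
  rw [Polynomial.aeval_eq_sum_range, Polynomial.eval_eq_sum_range]
  refine norm_sum_le_of_le _ fun i _ => ?_
  rw [norm_smul, Real.norm_of_nonneg (hp i)]
  refine mul_le_mul_of_nonneg_left ?_ (hp i)
  rw [one_pow]
  clear * - hX
  induction i with
  | zero => rw [pow_zero]; exact ContinuousLinearMap.norm_id_le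
  | succ i ih =>
    rw [pow_succ]
    exact (norm_mul_le _ _).trans (mul_le_one₀ ih (norm_nonneg _) hX)

theorem norm_le_one_of_quadratic {X : H →L[ℝ] H} (hX : (X : H →ₗ[ℝ] H).IsSymmetric)
    (h0 : ∀ x, 0 ≤ inner ℝ (X x) x) (h1 : ∀ x, inner ℝ (X x) x ≤ ‖x‖ ^ 2) : ‖X‖ ≤ 1 := by
  rw [ContinuousLinearMap.norm_eq_iSup_rayleighQuotient X hX]
  refine ciSup_le fun x => ?_
  have e : X.rayleighQuotient x = inner ℝ (X x) x / ‖x‖ ^ 2 := rfl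
  rw [e, abs_of_nonneg (div_nonneg (h0 x) (by positivity))]
  exact div_le_one_of_le₀ (h1 x) (by positivity)


theorem aeval_sqrtPoly_succ (X : H →L[ℝ] H) (n : ℕ) :
    Polynomial.aeval X (sqrtPoly (n + 1)) = (1 / 2 : ℝ) •
      (X + Polynomial.aeval X (sqrtPoly n) * Polynomial.aeval X (sqrtPoly n)) := by
  simp only [sqrtPoly, map_mul, map_add, Polynomial.aeval_X, Polynomial.aeval_C, pow_two]
  rw [Algebra.smul_def]

theorem isSymmetric_aeval {X : H →L[ℝ] H} (hX : (X : H →ₗ[ℝ] H).IsSymmetric) (n : ℕ) :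
    ((Polynomial.aeval X (sqrtPoly n) : H →L[ℝ] H) : H →ₗ[ℝ] H).IsSymmetric := by
  induction n with
  | zero => intro x y; simp [sqrtPoly]
  | succ n ih =>
    intro x y
    have hX' : ∀ x y, inner ℝ (X x) y = inner ℝ x (X y) := hX
    have ih' : ∀ x y, inner ℝ ((Polynomial.aeval X (sqrtPoly n) : H →L[ℝ] H) x) y =
      inner ℝ x ((Polynomial.aeval X (sqrtPoly n) : H →L[ℝ] H) y) := ih
    rw [aeval_sqrtPoly_succ]
    simp [inner_add_left, inner_add_right, inner_smul_left, inner_smul_right, hX', ih']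

theorem cauchySeq_aeval {X : H →L[ℝ] H} (hX : ‖X‖ ≤ 1) :
    CauchySeq fun n => (Polynomial.aeval X (sqrtPoly n) : H →L[ℝ] H) := by
  have hstep : ∀ n, ‖(Polynomial.aeval X (sqrtPoly (n + 1)) : H →L[ℝ] H) -
      Polynomial.aeval X (sqrtPoly n)‖ ≤
      (sqrtPoly (n + 1)).eval 1 - (sqrtPoly n).eval 1 := fun n => by
    have := norm_aeval_le hX (nonnegCoeff_sqrtPoly_succ_sub n)
    rwa [map_sub, Polynomial.eval_sub] at this
  refine cauchySeq_of_dist_le_of_summable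
    (fun n => (sqrtPoly (n + 1)).eval 1 - (sqrtPoly n).eval 1) (fun n => ?_) ?_
  · rw [dist_comm, dist_eq_norm]
    exact hstep n
  · refine summable_of_sum_range_le (c := 1)
      (fun n => (norm_nonneg _).trans (hstep n)) fun n => ?_
    rw [Finset.sum_range_sub (fun n => (sqrtPoly n).eval 1)]
    have : (sqrtPoly 0).eval 1 = 0 := by simp [sqrtPoly]
    rw [this, sub_zero]
    exact sqrtPoly_eval_one_le n

theorem exists_sq_eq_one_sub [CompleteSpace H] {X : H →L[ℝ] H}
    (hXs : (X : H →ₗ[ℝ] H).IsSymmetric) (hX : ‖X‖ ≤ 1) :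
    ∃ S : H →L[ℝ] H, S.IsPositive ∧ S * S = 1 - X := by
  obtain ⟨Z, hZ⟩ := cauchySeq_tendsto_of_complete (cauchySeq_aeval hX)
  have hZeq : Z = (1 / 2 : ℝ) • (X + Z * Z) := by
    refine tendsto_nhds_unique (hZ.comp (Filter.tendsto_add_atTop_nat 1)) ?_
    have h : ((fun n => (Polynomial.aeval X (sqrtPoly n) : H →L[ℝ] H)) ∘ fun n => n + 1) =
        fun n => (1 / 2 : ℝ) • (X + Polynomial.aeval X (sqrtPoly n) *
          Polynomial.aeval X (sqrtPoly n)) := by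
      funext n
      exact aeval_sqrtPoly_succ X n
    rw [h]
    exact (tendsto_const_nhds.add (hZ.mul hZ)).const_smul _
  have hpt : ∀ x, Filter.Tendsto (fun n => (Polynomial.aeval X (sqrtPoly n) : H →L[ℝ] H) x)
      Filter.atTop (nhds (Z x)) := fun x =>
    ((ContinuousLinearMap.apply ℝ H x).continuous.tendsto Z).comp hZ
  have hZsym : ∀ x y, inner ℝ (Z x) y = inner ℝ x (Z y) := fun x y => by
    refine tendsto_nhds_unique ((hpt x).inner tendsto_const_nhds)
      ((tendsto_const_nhds.inner (hpt y)).congr fun n => ?_)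
    exact (isSymmetric_aeval hXs n x y).symm
  have hZ1 : ‖Z‖ ≤ 1 := le_of_tendsto hZ.norm (Filter.Eventually.of_forall fun n =>
    (norm_aeval_le hX (nonnegCoeff_sqrtPoly n)).trans (sqrtPoly_eval_one_le n))
  refine ⟨1 - Z, ⟨fun x y => ?_, fun x => ?_⟩, ?_⟩
  · simp [inner_sub_left, inner_sub_right, hZsym]
  · have h1 : inner ℝ (Z x) x ≤ ‖x‖ * ‖x‖ :=
      (real_inner_le_norm _ _).trans (by
        gcongr
        simpa using Z.le_of_opNorm_le hZ1 x)
    have h2 : inner ℝ ((1 - Z : H →L[ℝ] H) x) x = ‖x‖ * ‖x‖ - inner ℝ (Z x) x := by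
      simp [inner_sub_left, pow_two]
    change 0 ≤ inner ℝ ((1 - Z : H →L[ℝ] H) x) x
    rw [h2]
    linarith
  · have h2 : (2 : ℝ) • Z = X + Z * Z := by
      conv_lhs => rw [hZeq]
      rw [smul_smul]; norm_num
    have h3 : (1 - Z) * (1 - Z) = 1 - (2 : ℝ) • Z + Z * Z := by
      rw [two_smul]; noncomm_ring
    rw [h3, h2]
    abel

/-- Every positive operator on a real Hilbert space has a positive square root. -/
theorem exists_isPositive_sq_eq [CompleteSpace H] (B : H →L[ℝ] H) (hB : B.IsPositive) :
    ∃ S : H →L[ℝ] H, S.IsPositive ∧ S * S = B := by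
  obtain ⟨c, hcpos, hc⟩ : ∃ c : ℝ, 0 < c ∧ ‖B‖ ≤ c :=
    ⟨‖B‖ + 1, by positivity, by linarith⟩
  have hBsym : ∀ x y, inner ℝ (B x) y = inner ℝ x (B y) := hB.isSymmetric
  have hin : ∀ x, inner ℝ ((1 - c⁻¹ • B : H →L[ℝ] H) x) x =
      ‖x‖ ^ 2 - c⁻¹ * inner ℝ (B x) x := fun x => by
    simp [inner_sub_left, inner_smul_left]
  have hXs : ((1 - c⁻¹ • B : H →L[ℝ] H) : H →ₗ[ℝ] H).IsSymmetric := fun x y => by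
    simp [inner_sub_left, inner_sub_right, inner_smul_left, inner_smul_right, hBsym]
  have hX1 : ‖(1 - c⁻¹ • B : H →L[ℝ] H)‖ ≤ 1 := by
    refine norm_le_one_of_quadratic hXs (fun x => ?_) fun x => ?_
    · rw [hin]
      have h1 : inner ℝ (B x) x ≤ c * ‖x‖ ^ 2 := by
        calc inner ℝ (B x) x ≤ ‖B x‖ * ‖x‖ := real_inner_le_norm _ _
          _ ≤ (c * ‖x‖) * ‖x‖ := by gcongr; exact B.le_of_opNorm_le hc x
          _ = c * ‖x‖ ^ 2 := by ring
      have := mul_le_mul_of_nonneg_left h1 (inv_nonneg.2 hcpos.le)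
      rw [inv_mul_cancel_left₀ hcpos.ne'] at this
      linarith
    · rw [hin]
      have := mul_nonneg (inv_nonneg.2 hcpos.le) (hB.inner_nonneg_left x)
      linarith
  obtain ⟨S, hS, hSS⟩ := exists_sq_eq_one_sub hXs hX1
  refine ⟨Real.sqrt c • S, hS.smul_of_nonneg (Real.sqrt_nonneg c), ?_⟩
  rw [smul_mul_smul_comm, hSS, Real.mul_self_sqrt hcpos.le, sub_sub_cancel, smul_smul,
    mul_inv_cancel₀ hcpos.ne', one_smul]

end Sqrt

/-! ### Gaussian measures, the Cameron-Martin space, translations -/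

section Gaussian

variable {H : Type*} [NormedAddCommGroup H] [InnerProductSpace ℝ H]

open Classical in
/-- The positive square root `B^{1/2}` of a positive operator `B` (and `0` if `B` is not
positive). -/
def sqrtOp [CompleteSpace H] (B : H →L[ℝ] H) : H →L[ℝ] H :=
  if hB : B.IsPositive then (exists_isPositive_sq_eq B hB).choose else 0

theorem sqrtOp_isPositive [CompleteSpace H] {B : H →L[ℝ] H} (hB : B.IsPositive) :
    (sqrtOp B).IsPositive := by
  rw [sqrtOp, dif_pos hB]
  exact (exists_isPositive_sq_eq B hB).choose_spec.1

theorem sqrtOp_mul_self [CompleteSpace H] {B : H →L[ℝ] H} (hB : B.IsPositive) :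
    sqrtOp B * sqrtOp B = B := by
  rw [sqrtOp, dif_pos hB]
  exact (exists_isPositive_sq_eq B hB).choose_spec.2

/-- `B > 0`: self-adjoint with `⟨B x, x⟩ > 0` for all `x ≠ 0`. -/
def StrictlyPositive (B : H →L[ℝ] H) : Prop :=
  B.IsPositive ∧ ∀ x : H, x ≠ 0 → 0 < inner ℝ (B x) x

/-- The Borel probability measure `μ` is the centred Gaussian measure with covariance operator `B`:
its characteristic functional is `y ↦ exp (-⟨B y, y⟩ / 2)`. -/
def IsCenteredGaussian [MeasurableSpace H] (μ : Measure H) (B : H →L[ℝ] H) : Prop :=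
  IsProbabilityMeasure μ ∧
    ∀ y : H, charFun μ y = Complex.exp (((-(1 / 2) * inner ℝ (B y) y : ℝ)) : ℂ)

/-- The Cameron-Martin space `H₀ = B^{1/2} H`. -/
def cameronMartin [CompleteSpace H] (B : H →L[ℝ] H) : Submodule ℝ H :=
  LinearMap.range (sqrtOp B : H →ₗ[ℝ] H)

/-- The norm `‖x‖₀ = ‖B^{-1/2} x‖` of `x ∈ H₀`, for `B` strictly positive (so that `B^{1/2}` is
injective). -/
def cameronMartinNorm [CompleteSpace H] (B : H →L[ℝ] H) (x : H) : ℝ :=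
  ‖Function.invFun (sqrtOp B) x‖

/-- `G` is a countable subgroup of `H₀` which is dense in `H₀` for the norm `‖·‖₀`. -/
structure IsCountableDense [CompleteSpace H] (B : H →L[ℝ] H) (G : AddSubgroup H) : Prop where
  countable : (G : Set H).Countable
  le : G ≤ (cameronMartin B).toAddSubgroup
  dense : ∀ f ∈ cameronMartin B, ∀ ε > 0, ∃ g ∈ G, cameronMartinNorm B (f - g) < ε

/-- The translation `L_f x = x + f`. -/
def translation [MeasurableSpace H] [BorelSpace H] (f : H) : H ≃ᵐ H :=
  (Homeomorph.addRight f).toMeasurableEquiv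

/-- The group `{L_f : f ∈ G}` of translations by the elements of a subgroup `G`. -/
def translations [MeasurableSpace H] [BorelSpace H] (G : AddSubgroup H) : Set (H ≃ᵐ H) :=
  translation '' (G : Set H)

end Gaussian

end GaussianTranslations

end

/-!
Let `S = B^{1/2}`. The map `S h ↦ ⟨h, ·⟩` extends to the Paley-Wiener isometry `W` from `H` into
`L²(μ)` (`exists_isPaleyWiener`), and the Cameron-Martin formula (`IsPaleyWiener.map_add_sqrt`) says
that the translation by `S g` is nonsingular with logarithmic cocycle `-W g - ‖g‖² / 2`
(`IsPaleyWiener.rnCocycle_eq`).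

Everything else rests on three facts about an orthonormal sequence `o` of `H`.
* The variables `W (o k)` are independent standard Gaussians. By Bessel's inequality, functions
  `η (W (o k))` are asymptotically independent of any `v ∈ L²(μ)`
  (`IsPaleyWiener.tendsto_integral_mul_comp`).
* `S (o k) → 0` in norm (`IsPaleyWiener.tendsto_sqrt_zero`).
* Hence translations by `S (o k)` change a fixed bounded function only little in `L¹(μ)`
  (`IsPaleyWiener.tendsto_integral_comp_add_sub`).

So for large `k` the translation by `S (o k)` almost preserves a given set, while its cocycle still
has the distribution `N(-1/2, 1)`, which charges every open set, and is nearly independent of the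
given set. For the orthonormal vectors `λ_k^{-1/2} S e_k` this shows at once that every real number
is an essential value. For a subgroup `G` that is dense in the Cameron-Martin norm, apply it to
vectors of `G` close to `S (o k)`. It follows that almost every section of a set invariant under the
Maharam extension is invariant under all translations of the line
(`IsPaleyWiener.sectionMass_eq`), so it is null or conull. This reduces the ergodicity of the
Maharam extension to that of `G` itself. The latter holds since an invariant set `A` is, by continuity,
invariant under all Cameron-Martin translations, which forces the restriction of `μ` to `A` and
`μ A • μ` to have the same Laplace transform (`IsPaleyWiener.measure_eq_zero_or_compl`).
-/

open MeasureTheory ProbabilityTheory Filter Topology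
open scoped NNReal ENNReal

namespace GaussianTranslations

/-! ### The Paley-Wiener map and the Cameron-Martin formula -/

section PaleyWiener

variable {H : Type*} [NormedAddCommGroup H] [InnerProductSpace ℝ H] [MeasurableSpace H]
  {μ : Measure H} {S : H →L[ℝ] H} {W : H →L[ℝ] Lp ℝ 2 μ}

/-- `W` is the Paley-Wiener map of the centred Gaussian measure `μ` with covariance `S²`: the
continuous linear extension of `S h ↦ ⟨h, ·⟩` to `H`. Thus `H` is identified with the
Cameron-Martin space through `S`, and `W g` is the centred Gaussian variable of variance `‖g‖²`
attached to the Cameron-Martin vector `S g`. -/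
structure IsPaleyWiener (μ : Measure H) (S : H →L[ℝ] H) (W : H →L[ℝ] Lp ℝ 2 μ) : Prop where
  isSymmetric : ∀ x y, inner ℝ (S x) y = inner ℝ x (S y)
  apply_sqrt : ∀ h, W (S h) =ᵐ[μ] fun x => inner ℝ h x
  integral_cexp : ∀ g, ∫ x, Complex.exp (W g x * Complex.I) ∂μ = Complex.exp (-(‖g‖ ^ 2 / 2 : ℝ))

theorem IsPaleyWiener.measurable (_h : IsPaleyWiener μ S W) (g : H) : Measurable (W g) :=
  (Lp.stronglyMeasurable (W g)).measurable

theorem IsPaleyWiener.map_eq [IsProbabilityMeasure μ] (hW : IsPaleyWiener μ S W) (g : H) :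
    μ.map (W g) = gaussianReal 0 (‖g‖₊ ^ 2) := by
  have := Measure.isProbabilityMeasure_map (μ := μ) (hW.measurable g).aemeasurable
  refine Measure.ext_of_charFun (funext fun t => ?_)
  rw [charFun_gaussianReal, charFun_apply_real,
    integral_map (hW.measurable g).aemeasurable (by fun_prop)]
  have h := hW.integral_cexp (t • g)
  have e : (W (t • g) : H → ℝ) =ᵐ[μ] fun x => t * W g x := by
    rw [map_smul]; exact Lp.coeFn_smul t (W g)
  rw [integral_congr_ae (g := fun x => Complex.exp (t * W g x * Complex.I))
    (by filter_upwards [e] with x hx; rw [hx]; push_cast; rfl)] at h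
  rw [h, norm_smul]
  congr 1
  push_cast
  rw [mul_pow, ← Complex.ofReal_pow, Real.norm_eq_abs, sq_abs]
  simp
  ring

theorem IsPaleyWiener.integrable_exp [IsProbabilityMeasure μ] (hW : IsPaleyWiener μ S W)
    (g : H) (r : ℝ) : Integrable (fun x => Real.exp (r * W g x)) μ := by
  have h : Integrable (fun y => Real.exp (r * y)) (μ.map (W g)) := by
    rw [hW.map_eq]; exact integrable_exp_mul_gaussianReal r
  exact h.comp_measurable (hW.measurable g)

theorem IsPaleyWiener.coeFn_lin (_hW : IsPaleyWiener μ S W) (r s : ℝ) (a b : H) :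
    (W (r • a + s • b) : H → ℝ) =ᵐ[μ] fun x => r * W a x + s * W b x := by
  rw [map_add, map_smul, map_smul]
  filter_upwards [Lp.coeFn_add (r • W a) (s • W b), Lp.coeFn_smul r (W a),
    Lp.coeFn_smul s (W b)] with x h1 h2 h3
  rw [h1, Pi.add_apply, h2, h3]; rfl

/-- Orthogonal vectors give independent Gaussian variables. -/
theorem IsPaleyWiener.indepFun [IsProbabilityMeasure μ] (hW : IsPaleyWiener μ S W) {a b : H}
    (hab : inner ℝ a b = 0) : IndepFun (W a) (W b) μ := by
  rw [indepFun_iff_charFun_prod (hW.measurable a).aemeasurable (hW.measurable b).aemeasurable]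
  intro t
  have h := hW.integral_cexp (t.fst • a + t.snd • b)
  have ma := hW.measurable a
  have mb := hW.measurable b
  rw [hW.map_eq, hW.map_eq, charFun_gaussianReal, charFun_gaussianReal, charFun_apply,
    integral_map (by fun_prop) (by fun_prop), ← Complex.exp_add]
  rw [integral_congr_ae (g := fun x => Complex.exp
    ((inner ℝ (WithLp.toLp 2 (W a x, W b x)) t : ℝ) * Complex.I))
    (by
      filter_upwards [hW.coeFn_lin t.fst t.snd a b] with x hx
      rw [hx]
      simp [WithLp.prod_inner_apply])] at h
  rw [h]
  congr 1
  have e : ‖t.fst • a + t.snd • b‖ ^ 2 = t.fst ^ 2 * ‖a‖ ^ 2 + t.snd ^ 2 * ‖b‖ ^ 2 := by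
    rw [norm_add_sq_real, norm_smul, norm_smul, inner_smul_left, inner_smul_right, hab, mul_pow,
      mul_pow, Real.norm_eq_abs, Real.norm_eq_abs, sq_abs, sq_abs]
    simp
  rw [e]
  push_cast
  simp
  ring

/-- The joint Laplace-Fourier transform `E exp (W g + i W a)`. -/
theorem IsPaleyWiener.integral_cexp_add [IsProbabilityMeasure μ] (hW : IsPaleyWiener μ S W)
    (a g : H) :
    ∫ x, Complex.exp (W g x + W a x * Complex.I) ∂μ =
      Complex.exp ((‖g‖ ^ 2 / 2 - ‖a‖ ^ 2 / 2 : ℝ) + (inner ℝ a g : ℝ) * Complex.I) := by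
  rcases eq_or_ne g 0 with rfl | hg
  · have e : (W (0 : H) : H → ℝ) =ᵐ[μ] 0 := by rw [map_zero]; exact Lp.coeFn_zero _ _ _
    rw [integral_congr_ae (g := fun x => Complex.exp (W a x * Complex.I))
      (by filter_upwards [e] with x hx; rw [hx]; simp), hW.integral_cexp]
    simp
  · -- Split `a = α g + b` with `b` orthogonal to `g`.
    have hg2 : ‖g‖ ^ 2 ≠ 0 := by positivity
    set α : ℝ := inner ℝ a g / ‖g‖ ^ 2 with hα
    set b : H := a - α • g with hb
    have hbg : inner ℝ b g = 0 := by
      rw [hb, inner_sub_left, inner_smul_left, real_inner_self_eq_norm_sq]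
      simp [hα, hg2]
    have ha : a = α • g + (1 : ℝ) • b := by rw [hb]; simp
    have hna : ‖a‖ ^ 2 = α ^ 2 * ‖g‖ ^ 2 + ‖b‖ ^ 2 := by
      conv_lhs => rw [ha]
      rw [norm_add_sq_real, one_smul, norm_smul, inner_smul_left, real_inner_comm, hbg, mul_pow,
        Real.norm_eq_abs, sq_abs]
      simp
    have mg := hW.measurable g
    have mb := hW.measurable b
    have hind : IndepFun (fun x => Complex.exp (W b x * Complex.I))
        (fun x => Complex.exp ((1 + α * Complex.I) * W g x)) μ :=
      (hW.indepFun hbg).comp (φ := fun y : ℝ => Complex.exp (y * Complex.I))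
        (ψ := fun y : ℝ => Complex.exp ((1 + α * Complex.I) * y)) (by fun_prop) (by fun_prop)
    have h2 := complexMGF_gaussianReal (hW.map_eq g) (1 + α * Complex.I)
    rw [complexMGF] at h2
    rw [integral_congr_ae (g := fun x => Complex.exp (W b x * Complex.I) *
      Complex.exp ((1 + α * Complex.I) * W g x)) (by
        have := hW.coeFn_lin α 1 g b
        rw [← ha] at this
        filter_upwards [this] with x hx
        rw [hx, ← Complex.exp_add]
        push_cast
        ring_nf),
      hind.integral_fun_mul_eq_mul_integral (by fun_prop) (by fun_prop), hW.integral_cexp, h2,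
      ← Complex.exp_add]
    have hag : inner ℝ a g = α * ‖g‖ ^ 2 := by rw [hα]; field_simp
    rw [hna, hag]
    congr 1
    push_cast
    simp
    ring_nf
    simp
    ring

variable [BorelSpace H] [CompleteSpace H] [SecondCountableTopology H]

/-- The **Cameron-Martin formula**. -/
theorem IsPaleyWiener.map_add_sqrt [IsProbabilityMeasure μ] (hW : IsPaleyWiener μ S W) (g : H) :
    μ.map (fun x => x + S g) =
      μ.withDensity fun x => ENNReal.ofReal (Real.exp (W g x - ‖g‖ ^ 2 / 2)) := by
  have mg := hW.measurable g
  have hi : Integrable (fun x => Real.exp (W g x - ‖g‖ ^ 2 / 2)) μ := by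
    have := (hW.integrable_exp g 1).mul_const (Real.exp (-(‖g‖ ^ 2 / 2)))
    refine this.congr (ae_of_all _ fun x => ?_)
    simp only
    rw [← Real.exp_add]; ring_nf
  have := isFiniteMeasure_withDensity_ofReal hi.hasFiniteIntegral
  refine Measure.ext_of_charFun (funext fun y => ?_)
  rw [charFun_map_add_const, charFun_apply, charFun_apply]
  rw [integral_withDensity_eq_integral_toReal_smul (by fun_prop) (by simp)]
  have h1 := hW.integral_cexp (S y)
  rw [integral_congr_ae (g := fun x => Complex.exp ((inner ℝ x y : ℝ) * Complex.I)) (by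
    filter_upwards [hW.apply_sqrt y] with x hx; rw [hx, real_inner_comm])] at h1
  have h2 := hW.integral_cexp_add (S y) g
  rw [h1]
  have e : ∀ᵐ x ∂μ, (ENNReal.ofReal (Real.exp (W g x - ‖g‖ ^ 2 / 2))).toReal •
      Complex.exp ((inner ℝ x y : ℝ) * Complex.I) =
      Complex.exp (-(‖g‖ ^ 2 / 2 : ℝ)) * Complex.exp (W g x + W (S y) x * Complex.I) := by
    filter_upwards [hW.apply_sqrt y] with x hx
    rw [hx, ENNReal.toReal_ofReal (Real.exp_pos _).le, Complex.real_smul, Complex.ofReal_exp,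
      ← Complex.exp_add, ← Complex.exp_add, real_inner_comm]
    push_cast
    ring_nf
  rw [integral_congr_ae e, integral_const_mul, h2, ← Complex.exp_add, ← Complex.exp_add,
    hW.isSymmetric, real_inner_comm]
  congr 1
  push_cast
  ring

theorem IsPaleyWiener.lintegral_add_sqrt [IsProbabilityMeasure μ] (hW : IsPaleyWiener μ S W)
    (g : H) {u : H → ℝ≥0∞} (hu : Measurable u) :
    ∫⁻ x, u (x + S g) ∂μ =
      ∫⁻ x, ENNReal.ofReal (Real.exp (W g x - ‖g‖ ^ 2 / 2)) * u x ∂μ := by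
  have mg := hW.measurable g
  rw [← lintegral_map (f := u) (g := fun x => x + S g) hu (by fun_prop), hW.map_add_sqrt,
    lintegral_withDensity_eq_lintegral_mul _ (by fun_prop) hu]
  rfl

theorem IsPaleyWiener.nonsingular [IsProbabilityMeasure μ] (hW : IsPaleyWiener μ S W) (g : H) :
    Nonsingular μ (translation (S g)) := by
  have mg := hW.measurable g
  have e : μ.map (translation (S g)) = _ := hW.map_add_sqrt g
  rw [Nonsingular, e]
  refine ⟨withDensity_absolutelyContinuous _ _,
    withDensity_absolutelyContinuous' (by fun_prop) (ae_of_all _ fun x => ?_)⟩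
  simpa using Real.exp_pos _

theorem IsPaleyWiener.rnCocycle_eq [IsProbabilityMeasure μ] (hW : IsPaleyWiener μ S W) (g : H) :
    rnCocycle μ (translation (S g)) =ᵐ[μ] fun x => -W g x - ‖g‖ ^ 2 / 2 := by
  have mg := hW.measurable (-g)
  have e : μ.map (translation (S g)).symm =
      μ.withDensity fun x => ENNReal.ofReal (Real.exp (W (-g) x - ‖-g‖ ^ 2 / 2)) := by
    rw [← hW.map_add_sqrt, map_neg]; rfl
  have hneg : (W (-g) : H → ℝ) =ᵐ[μ] fun x => -W g x := by
    rw [map_neg]; exact Lp.coeFn_neg (W g)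
  have := Measure.rnDeriv_withDensity μ
    (f := fun x => ENNReal.ofReal (Real.exp (W (-g) x - ‖-g‖ ^ 2 / 2))) (by fun_prop)
  filter_upwards [this, hneg] with x h1 h2
  rw [rnCocycle, e, h1, ENNReal.toReal_ofReal (Real.exp_pos _).le, Real.log_exp, h2, norm_neg]

theorem measurable_rnCocycle {Y : Type*} [MeasurableSpace Y] (ν : Measure Y) (γ : Y ≃ᵐ Y) :
    Measurable (rnCocycle ν γ) :=
  Real.measurable_log.comp (Measure.measurable_rnDeriv _ _).ennreal_toReal

end PaleyWiener

/-! ### Existence of the Paley-Wiener map -/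

/-- The `L¹` norm of a variable in `L²` of a probability space is at most its `L²` norm. -/
theorem integral_abs_Lp_le {Ω : Type*} [MeasurableSpace Ω] {μ : Measure Ω}
    [IsProbabilityMeasure μ] (f : Lp ℝ 2 μ) : ∫ x, |f x| ∂μ ≤ ‖f‖ := by
  have h1 : eLpNorm f 1 μ ≤ eLpNorm f 2 μ :=
    eLpNorm_le_eLpNorm_of_exponent_le (by norm_num) (Lp.aestronglyMeasurable f)
  have h2 := ENNReal.toReal_mono (Lp.eLpNorm_ne_top f) h1
  rw [Lp.norm_def]
  refine le_trans (le_of_eq ?_) h2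
  have hi : Integrable f μ := (Lp.memLp f).integrable (by norm_num)
  rw [eLpNorm_one_eq_lintegral_enorm, ← integral_norm_eq_lintegral_enorm hi.1]
  rfl

theorem integrable_Lp {Ω : Type*} [MeasurableSpace Ω] {μ : Measure Ω}
    [IsProbabilityMeasure μ] (f : Lp ℝ 2 μ) : Integrable f μ :=
  (Lp.memLp f).integrable (by norm_num)

theorem norm_integral_cexp_sub_le {Ω : Type*} [MeasurableSpace Ω] {μ : Measure Ω}
    [IsProbabilityMeasure μ] (f g : Lp ℝ 2 μ) :
    ‖∫ x, Complex.exp (f x * Complex.I) ∂μ - ∫ x, Complex.exp (g x * Complex.I) ∂μ‖ ≤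
      ‖f - g‖ := by
  have hb : ∀ f : Lp ℝ 2 μ, Integrable (fun x => Complex.exp (f x * Complex.I)) μ := fun f => by
    have m : Measurable f := (Lp.stronglyMeasurable f).measurable
    refine Integrable.of_bound (by fun_prop) 1 (ae_of_all _ fun x => ?_)
    rw [Complex.norm_exp_ofReal_mul_I]
  rw [← integral_sub (hb f) (hb g)]
  refine (norm_integral_le_of_norm_le (integrable_Lp (f - g)).abs ?_).trans
    (integral_abs_Lp_le (f - g))
  filter_upwards [Lp.coeFn_sub f g] with x hx
  rw [hx, Pi.sub_apply]
  have e : Complex.exp (f x * Complex.I) - Complex.exp (g x * Complex.I) =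
      Complex.exp (g x * Complex.I) * (Complex.exp (Complex.I * (f x - g x : ℝ)) - 1) := by
    rw [mul_sub, mul_one, ← Complex.exp_add]
    push_cast
    ring_nf
  rw [e, norm_mul, Complex.norm_exp_ofReal_mul_I, one_mul]
  exact Real.norm_exp_I_mul_ofReal_sub_one_le

section Existence

variable {H : Type*} [NormedAddCommGroup H] [InnerProductSpace ℝ H] [MeasurableSpace H]
  [BorelSpace H] [SecondCountableTopology H] {μ : Measure H} {S : H →L[ℝ] H}

theorem map_inner_eq_gaussianReal [IsProbabilityMeasure μ]
    (hμ : ∀ y, charFun μ y = Complex.exp (-(‖S y‖ ^ 2 / 2 : ℝ))) (h : H) :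
    μ.map (fun x => inner ℝ h x) = gaussianReal 0 (‖S h‖₊ ^ 2) := by
  have m : Measurable (fun x : H => inner ℝ h x) := by fun_prop
  have := Measure.isProbabilityMeasure_map (μ := μ) m.aemeasurable
  refine Measure.ext_of_charFun (funext fun t => ?_)
  rw [charFun_gaussianReal, charFun_apply_real, integral_map m.aemeasurable (by fun_prop)]
  have e := hμ (t • h)
  rw [charFun_apply, map_smul, norm_smul] at e
  simp only [inner_smul_right, Complex.ofReal_mul, real_inner_comm] at e
  rw [e]
  congr 1
  push_cast
  rw [mul_pow, ← Complex.ofReal_pow, Real.norm_eq_abs, sq_abs]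
  simp
  ring

theorem memLp_inner [IsProbabilityMeasure μ]
    (hμ : ∀ y, charFun μ y = Complex.exp (-(‖S y‖ ^ 2 / 2 : ℝ))) (h : H) :
    MemLp (fun x => inner ℝ h x) 2 μ := by
  have m : Measurable (fun x : H => inner ℝ h x) := by fun_prop
  have := memLp_id_gaussianReal' (μ := 0) (v := ‖S h‖₊ ^ 2) 2 (by simp)
  rw [← map_inner_eq_gaussianReal hμ h] at this
  exact this.comp_of_map m.aemeasurable

theorem integral_inner_sq [IsProbabilityMeasure μ]
    (hμ : ∀ y, charFun μ y = Complex.exp (-(‖S y‖ ^ 2 / 2 : ℝ))) (h : H) :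
    ∫ x, inner ℝ h x ^ 2 ∂μ = ‖S h‖ ^ 2 := by
  have m : Measurable (fun x : H => inner ℝ h x) := by fun_prop
  rw [← integral_map (f := fun y : ℝ => y ^ 2) m.aemeasurable (by fun_prop),
    map_inner_eq_gaussianReal hμ h]
  have := variance_eq_integral (X := fun x : ℝ => x) (μ := gaussianReal 0 (‖S h‖₊ ^ 2))
    (by fun_prop)
  rw [variance_fun_id_gaussianReal] at this
  simpa using this.symm

/-- The linear map `h ↦ ⟨h, ·⟩` into `L²(μ)`. -/
def innerLp [IsProbabilityMeasure μ]
    (hμ : ∀ y, charFun μ y = Complex.exp (-(‖S y‖ ^ 2 / 2 : ℝ))) : H →ₗ[ℝ] Lp ℝ 2 μ where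
  toFun h := (memLp_inner hμ h).toLp _
  map_add' a b := by
    rw [← MemLp.toLp_add]
    exact MemLp.toLp_congr _ _ (ae_of_all _ fun x => by simp [inner_add_left])
  map_smul' r a := by
    rw [RingHom.id_apply, ← MemLp.toLp_const_smul]
    exact MemLp.toLp_congr _ _ (ae_of_all _ fun x => by simp [inner_smul_left])

theorem norm_innerLp [IsProbabilityMeasure μ]
    (hμ : ∀ y, charFun μ y = Complex.exp (-(‖S y‖ ^ 2 / 2 : ℝ))) (h : H) :
    ‖innerLp hμ h‖ = ‖S h‖ := by
  have e : ‖innerLp hμ h‖ ^ 2 = ‖S h‖ ^ 2 := by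
    rw [← real_inner_self_eq_norm_sq, L2.inner_def, ← integral_inner_sq hμ h]
    refine integral_congr_ae ?_
    filter_upwards [(memLp_inner hμ h).coeFn_toLp] with x hx
    change inner ℝ ((memLp_inner hμ h).toLp _ x) ((memLp_inner hμ h).toLp _ x) = _
    rw [hx, real_inner_self_eq_norm_sq, Real.norm_eq_abs, sq_abs]
  exact (sq_eq_sq₀ (norm_nonneg _) (norm_nonneg _)).1 e

/-- The Paley-Wiener map exists: `h ↦ ⟨h, ·⟩` factors isometrically through the injective operator
`S`, whose range is dense because `S` is symmetric. -/
theorem exists_isPaleyWiener [CompleteSpace H] [IsProbabilityMeasure μ]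
    (hμ : ∀ y, charFun μ y = Complex.exp (-(‖S y‖ ^ 2 / 2 : ℝ)))
    (hS : ∀ x y, inner ℝ (S x) y = inner ℝ x (S y)) (hinj : ∀ x, S x = 0 → x = 0) :
    ∃ W : H →L[ℝ] Lp ℝ 2 μ, IsPaleyWiener μ S W := by
  have hd : DenseRange (S : H →ₗ[ℝ] H) := by
    have h : (LinearMap.range (S : H →ₗ[ℝ] H))ᗮ = ⊥ := by
      rw [eq_bot_iff]
      intro x hx
      rw [Submodule.mem_orthogonal] at hx
      refine hinj x (ext_inner_left ℝ fun y => ?_)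
      rw [inner_zero_right, ← hS]
      exact hx _ ⟨y, rfl⟩
    have h2 := Submodule.topologicalClosure_eq_top_iff.2 h
    have h3 := Submodule.dense_iff_topologicalClosure_eq_top.2 h2
    rwa [LinearMap.coe_range] at h3
  have hn : ∃ C, ∀ x, ‖innerLp hμ x‖ ≤ C * ‖(S : H →ₗ[ℝ] H) x‖ :=
    ⟨1, fun x => by rw [one_mul, norm_innerLp]; rfl⟩
  have hext := LinearMap.extendOfNorm_eq hd hn
  refine ⟨(innerLp hμ).extendOfNorm (S : H →ₗ[ℝ] H), hS, fun h => ?_, fun g => ?_⟩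
  · have := hext h
    rw [ContinuousLinearMap.coe_coe] at this
    rw [this]
    exact (memLp_inner hμ h).coeFn_toLp
  · refine hd.induction_on (p := fun g => ∫ x, Complex.exp
      (((innerLp hμ).extendOfNorm (S : H →ₗ[ℝ] H) g : Lp ℝ 2 μ) x * Complex.I) ∂μ =
        Complex.exp (-(‖g‖ ^ 2 / 2 : ℝ))) g ?_ fun h => ?_
    · refine isClosed_eq ?_ (by fun_prop)
      have hc : Continuous fun f : Lp ℝ 2 μ => ∫ x, Complex.exp (f x * Complex.I) ∂μ :=
        (LipschitzWith.of_dist_le_mul (K := 1) fun f g => by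
          rw [dist_eq_norm, dist_eq_norm, NNReal.coe_one, one_mul]
          exact norm_integral_cexp_sub_le f g).continuous
      exact hc.comp (ContinuousLinearMap.continuous _)
    · rw [hext h]
      have := hμ h
      rw [charFun_apply] at this
      rw [ContinuousLinearMap.coe_coe, ← this]
      refine integral_congr_ae ?_
      filter_upwards [(memLp_inner hμ h).coeFn_toLp] with x hx
      change Complex.exp (((memLp_inner hμ h).toLp _ x : ℝ) * Complex.I) = _
      rw [hx, real_inner_comm]

end Existence

/-! ### Mixing and continuity of translations -/

theorem exists_orthonormal_nat {H : Type*} [NormedAddCommGroup H] [InnerProductSpace ℝ H]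
    [CompleteSpace H] (hdim : ¬ FiniteDimensional ℝ H) : ∃ o : ℕ → H, Orthonormal ℝ o := by
  obtain ⟨w, b, hb⟩ := exists_hilbertBasis ℝ H
  have hw : Infinite w := by
    by_contra hfin
    rw [not_infinite_iff_finite] at hfin
    have : FiniteDimensional ℝ (Submodule.span ℝ (Set.range b)) :=
      FiniteDimensional.span_of_finite ℝ (Set.finite_range b)
    have h1 := b.dense_span
    rw [(Submodule.closed_of_finiteDimensional _).submodule_topologicalClosure_eq] at h1
    rw [h1] at this
    exact hdim (Module.Finite.equiv Submodule.topEquiv)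
  exact ⟨_, b.orthonormal.comp _ (Infinite.natEmbedding w).injective⟩

theorem tendsto_inner_zero_of_orthonormal {E : Type*} [NormedAddCommGroup E] [InnerProductSpace ℝ E]
    {o : ℕ → E} (ho : Orthonormal ℝ o) (x : E) :
    Tendsto (fun k => inner ℝ (o k) x) atTop (𝓝 0) := by
  have h := (ho.inner_products_summable x).tendsto_atTop_zero
  have h2 := h.sqrt
  simp only [Real.sqrt_zero, Real.sqrt_sq (norm_nonneg _)] at h2
  exact tendsto_zero_iff_norm_tendsto_zero.2 h2

section Mixing

variable {H : Type*} [NormedAddCommGroup H] [InnerProductSpace ℝ H] [MeasurableSpace H]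
  {μ : Measure H} {S : H →L[ℝ] H} {W : H →L[ℝ] Lp ℝ 2 μ}

theorem tendsto_inner_zero_of_pairwise_orthogonal {E : Type*} [NormedAddCommGroup E]
    [InnerProductSpace ℝ E] {X : ℕ → E} {σ : ℝ} (hσ : ∀ k, ‖X k‖ = σ)
    (hX : Pairwise fun j k => inner ℝ (X j) (X k) = 0) (x : E) :
    Tendsto (fun k => inner ℝ (X k) x) atTop (𝓝 0) := by
  rcases eq_or_ne σ 0 with h0 | h0
  · have : ∀ k, X k = 0 := fun k => norm_eq_zero.1 ((hσ k).trans h0)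
    simp [this]
  · have ho : Orthonormal ℝ fun k => σ⁻¹ • X k := by
      refine ⟨fun k => ?_, fun j k hjk => ?_⟩
      · have : 0 ≤ σ := (hσ k) ▸ norm_nonneg _
        rw [norm_smul, hσ, norm_inv, Real.norm_of_nonneg this, inv_mul_cancel₀ h0]
      · simp [inner_smul_left, inner_smul_right, hX hjk]
    have h := (tendsto_inner_zero_of_orthonormal ho x).const_mul σ
    simpa [inner_smul_left, h0] using h

/-- Mixing: along an orthonormal sequence `o`, the independent variables `η (W (o k))` decouple
from every `v ∈ L²(μ)`. Centred, they are pairwise orthogonal of constant norm, hence weakly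
null by Bessel's inequality. -/
theorem IsPaleyWiener.tendsto_integral_mul_comp [IsProbabilityMeasure μ]
    (hW : IsPaleyWiener μ S W) {o : ℕ → H} (ho : Orthonormal ℝ o) {v : H → ℝ} (hv : MemLp v 2 μ)
    {η : ℝ → ℝ} (hη : Measurable η) {C : ℝ} (hC : ∀ y, |η y| ≤ C) :
    Tendsto (fun k => ∫ x, v x * η (W (o k) x) ∂μ) atTop
      (𝓝 ((∫ x, v x ∂μ) * ∫ y, η y ∂gaussianReal 0 1)) := by
  have hmap : ∀ k, μ.map (W (o k)) = gaussianReal 0 1 := fun k => by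
    rw [hW.map_eq, ho.nnnorm_eq_one k, one_pow]
  have m : ∀ k, Measurable (W (o k)) := fun k => hW.measurable _
  set c := ∫ y, η y ∂gaussianReal 0 1 with hc
  have hηi : Integrable η (gaussianReal 0 1) := Integrable.of_bound (by fun_prop) C (ae_of_all _ hC)
  set η' : ℝ → ℝ := fun y => η y - c with hη'
  have mη' : Measurable η' := by fun_prop
  have hb : ∀ y, ‖η' y‖ ≤ C + |c| := fun y => (norm_sub_le _ _).trans (add_le_add (hC y) le_rfl)
  have mk : ∀ k, AEStronglyMeasurable (fun x => η' (W (o k) x)) μ := fun k =>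
    (mη'.comp (m k)).aestronglyMeasurable
  have hL : ∀ k, MemLp (fun x => η' (W (o k) x)) 2 μ := fun k =>
    MemLp.of_bound (mk k) (C + |c|) (ae_of_all _ fun x => hb _)
  have hint : ∀ k (f : ℝ → ℝ), Measurable f →
      ∫ x, f (W (o k) x) ∂μ = ∫ y, f y ∂gaussianReal 0 1 := fun k f hf => by
    rw [← hmap k, integral_map (m k).aemeasurable hf.aestronglyMeasurable]
  have hmean : ∀ k, ∫ x, η' (W (o k) x) ∂μ = 0 := fun k => by
    rw [hint k η' mη', hη', integral_sub hηi (integrable_const _)]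
    simp [hc]
  have hin : ∀ k (f : H → ℝ) (hf : MemLp f 2 μ),
      inner ℝ ((hL k).toLp _) (hf.toLp f) = ∫ x, f x * η' (W (o k) x) ∂μ := fun k f hf => by
    rw [L2.inner_def]
    refine integral_congr_ae ?_
    filter_upwards [(hL k).coeFn_toLp, hf.coeFn_toLp] with x h1 h2
    rw [h1, h2]
    rfl
  have hnorm : ∀ k, ‖(hL k).toLp _‖ = Real.sqrt (∫ y, η' y * η' y ∂gaussianReal 0 1) := fun k => by
    rw [norm_eq_sqrt_real_inner, hin k _ (hL k), hint k (fun y => η' y * η' y) (by fun_prop)]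
  have hpair : Pairwise fun j k => inner ℝ ((hL j).toLp _) ((hL k).toLp _) = (0 : ℝ) := by
    intro j k hjk
    rw [hin j _ (hL k)]
    have hi : IndepFun (fun x => η' (W (o k) x)) (fun x => η' (W (o j) x)) μ :=
      (hW.indepFun (ho.2 hjk.symm)).comp mη' mη'
    rw [hi.integral_fun_mul_eq_mul_integral (mk k) (mk j), hmean, zero_mul]
  have hmain := tendsto_inner_zero_of_pairwise_orthogonal hnorm hpair (hv.toLp v)
  simp only [hin] at hmain
  have hvi : Integrable v μ := hv.integrable (by norm_num)
  have e : ∀ k, ∫ x, v x * η (W (o k) x) ∂μ =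
      ∫ x, v x * η' (W (o k) x) ∂μ + (∫ x, v x ∂μ) * c := fun k => by
    rw [← integral_mul_const, ← integral_add ((hvi.mul_bdd (c := C + |c|) (mk k)
      (ae_of_all _ fun x => hb _))) (hvi.mul_const c)]
    refine integral_congr_ae (ae_of_all _ fun x => ?_)
    simp only [hη']
    ring
  simp only [e]
  simpa using hmain.add_const ((∫ x, v x ∂μ) * c)

/-- A Gaussian covariance is compact along orthonormal sequences: `⟨o k, x⟩ → 0` for every `x`
by Bessel's inequality, so the variances `‖S (o k)‖²` of these variables tend to `0`. -/
theorem IsPaleyWiener.tendsto_sqrt_zero [BorelSpace H] [SecondCountableTopology H]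
    [IsProbabilityMeasure μ] (hW : IsPaleyWiener μ S W)
    {o : ℕ → H} (ho : Orthonormal ℝ o) : Tendsto (fun k => S (o k)) atTop (𝓝 0) := by
  have h1 : ∀ k, ∫ x, Complex.exp ((inner ℝ (o k) x : ℝ) * Complex.I) ∂μ =
      ((Real.exp (-(‖S (o k)‖ ^ 2 / 2)) : ℝ) : ℂ) := fun k => by
    have := hW.integral_cexp (S (o k))
    rw [integral_congr_ae (g := fun x => Complex.exp ((inner ℝ (o k) x : ℝ) * Complex.I))
      (by filter_upwards [hW.apply_sqrt (o k)] with x hx; rw [hx])] at this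
    rw [this]
    push_cast
    rfl
  have h2 : Tendsto (fun k => ∫ x, Complex.exp ((inner ℝ (o k) x : ℝ) * Complex.I) ∂μ) atTop
      (𝓝 (∫ _, (1 : ℂ) ∂μ)) := by
    refine tendsto_integral_of_dominated_convergence (fun _ => 1) (fun k => by fun_prop)
      (integrable_const _) (fun k => ae_of_all _ fun x => ?_) (ae_of_all _ fun x => ?_)
    · rw [Complex.norm_exp_ofReal_mul_I]
    · have h := tendsto_inner_zero_of_orthonormal ho x
      have hcont : Continuous fun r : ℝ => Complex.exp (r * Complex.I) := by fun_prop
      have := (hcont.tendsto 0).comp h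
      simpa [Function.comp_def] using this
  simp only [h1, integral_const, probReal_univ, one_smul] at h2
  have h3 : Tendsto (fun k => Real.exp (-(‖S (o k)‖ ^ 2 / 2))) atTop (𝓝 1) := by
    rw [← Complex.ofReal_one] at h2
    exact tendsto_ofReal_iff.1 h2
  have h4 := (h3.log one_ne_zero)
  simp only [Real.log_exp, Real.log_one] at h4
  have h5 := (h4.const_mul (-2)).sqrt
  have e : ∀ k, Real.sqrt (-2 * -(‖S (o k)‖ ^ 2 / 2)) = ‖S (o k)‖ := fun k => by
    rw [show -2 * -(‖S (o k)‖ ^ 2 / 2) = ‖S (o k)‖ ^ 2 by ring, Real.sqrt_sq (norm_nonneg _)]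
  simp only [e, mul_zero, Real.sqrt_zero] at h5
  exact tendsto_zero_iff_norm_tendsto_zero.2 h5

end Mixing

section Continuity

variable {H : Type*} [NormedAddCommGroup H] [InnerProductSpace ℝ H] [MeasurableSpace H]
  {μ : Measure H} {S : H →L[ℝ] H} {W : H →L[ℝ] Lp ℝ 2 μ}

/-- The Cameron-Martin density has `L²` norm `exp (‖g‖² / 2)`. -/
theorem IsPaleyWiener.eLpNorm_density_le [IsProbabilityMeasure μ] (hW : IsPaleyWiener μ S W)
    {g : H} {R : ℝ} (hg : ‖g‖ ≤ R) :
    eLpNorm (fun x => Real.exp (W g x - ‖g‖ ^ 2 / 2)) 2 μ ≤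
      ENNReal.ofReal (Real.exp (R ^ 2 / 2)) := by
  have mg := hW.measurable g
  have h2 := mgf_gaussianReal (hW.map_eq g) 2
  rw [mgf] at h2
  have hexp : ∀ x, ‖Real.exp (W g x - ‖g‖ ^ 2 / 2)‖ ^ 2 =
      Real.exp (-‖g‖ ^ 2) * Real.exp (2 * W g x) := fun x => by
    rw [Real.norm_eq_abs, sq_abs, ← Real.exp_nat_mul, ← Real.exp_add]
    push_cast
    ring_nf
  have hm : MemLp (fun x => Real.exp (W g x - ‖g‖ ^ 2 / 2)) 2 μ := by
    rw [memLp_two_iff_integrable_sq_norm (by fun_prop)]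
    simp only [hexp]
    exact (hW.integrable_exp g 2).const_mul _
  rw [hm.eLpNorm_eq_integral_rpow_norm (by norm_num) (by norm_num)]
  refine ENNReal.ofReal_le_ofReal ?_
  have h3 : ∫ x, ‖Real.exp (W g x - ‖g‖ ^ 2 / 2)‖ ^ (2 : ℝ≥0∞).toReal ∂μ =
      Real.exp (‖g‖ ^ 2) := by
    simp only [ENNReal.toReal_ofNat, Real.rpow_ofNat, hexp]
    rw [integral_const_mul, h2, ← Real.exp_add]
    congr 1
    push_cast
    simp
    ring
  rw [h3, ← Real.exp_mul]
  refine Real.exp_le_exp.2 ?_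
  have : ‖g‖ ^ 2 ≤ R ^ 2 := by gcongr
  simp
  linarith

variable [BorelSpace H] [CompleteSpace H] [SecondCountableTopology H]

theorem IsPaleyWiener.eLpNorm_comp_add_sqrt_le [IsProbabilityMeasure μ]
    (hW : IsPaleyWiener μ S W) {g : H} {R : ℝ} (hg : ‖g‖ ≤ R) {d : H → ℝ} (hd : Measurable d) :
    eLpNorm (fun x => d (x + S g)) 1 μ ≤
      ENNReal.ofReal (Real.exp (R ^ 2 / 2)) * eLpNorm d 2 μ := by
  have mg := hW.measurable g
  have e : eLpNorm (fun x => d (x + S g)) 1 μ =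
      eLpNorm ((fun x => Real.exp (W g x - ‖g‖ ^ 2 / 2)) • d) 1 μ := by
    rw [eLpNorm_one_eq_lintegral_enorm, eLpNorm_one_eq_lintegral_enorm,
      hW.lintegral_add_sqrt g (u := fun x => ‖d x‖ₑ) (by fun_prop)]
    refine lintegral_congr fun x => ?_
    rw [Pi.smul_apply', smul_eq_mul, enorm_mul, Real.enorm_of_nonneg (Real.exp_pos _).le]
  rw [e]
  refine (eLpNorm_smul_le_mul_eLpNorm (p := 2) (q := 2) (r := 1) hd.aestronglyMeasurable
    (by fun_prop)).trans ?_
  gcongr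
  exact hW.eLpNorm_density_le hg

/-- Translations act continuously from `L²` to `L¹`: the Cameron-Martin norms being bounded, it
is enough that the translation vectors converge in the norm of `H`. -/
theorem IsPaleyWiener.tendsto_integral_comp_add_sub [IsProbabilityMeasure μ]
    (hW : IsPaleyWiener μ S W) {g : ℕ → H} {g₀ : H} {R : ℝ} (hR : ∀ k, ‖g k‖ ≤ R)
    (hR₀ : ‖g₀‖ ≤ R) (hg : Tendsto (fun k => S (g k)) atTop (𝓝 (S g₀))) {u : H → ℝ}
    (hu : Measurable u) {M : ℝ} (hM : ∀ x, |u x| ≤ M) :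
    Tendsto (fun k => ∫ x, |u (x + S (g k)) - u (x + S g₀)| ∂μ) atTop (𝓝 0) := by
  have hu2 : MemLp u 2 μ := MemLp.of_bound hu.aestronglyMeasurable M (ae_of_all _ hM)
  have key : Tendsto (fun k => eLpNorm (fun x => u (x + S (g k)) - u (x + S g₀)) 1 μ) atTop
      (𝓝 0) := by
    rw [ENNReal.tendsto_nhds_zero]
    intro ε hε
    set K := ENNReal.ofReal (Real.exp (R ^ 2 / 2)) with hK
    have hK0 : K ≠ 0 := by simpa [hK] using Real.exp_pos _
    have hKt : K ≠ ∞ := ENNReal.ofReal_ne_top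
    obtain ⟨δ, hδ, hδε⟩ : ∃ δ : ℝ≥0∞, δ ≠ 0 ∧ K * δ ≤ ε / 3 := by
      rcases eq_or_ne ε ∞ with rfl | hεt
      · exact ⟨1, one_ne_zero, by simp [ENNReal.top_div]⟩
      · refine ⟨ε / 3 / K, ?_, by rw [ENNReal.mul_div_cancel hK0 hKt]⟩
        simp [hε.ne', hKt]
    obtain ⟨φ, hφ, -⟩ := hu2.exists_boundedContinuous_eLpNorm_sub_le (by norm_num) hδ
    have mφ : Measurable φ := φ.continuous.measurable
    have hd : Measurable (u - ⇑φ) := hu.sub mφ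
    have hlim : Tendsto (fun k => eLpNorm (fun x => φ (x + S (g k)) - φ (x + S g₀)) 1 μ) atTop
        (𝓝 0) := by
      simp only [eLpNorm_one_eq_lintegral_enorm]
      have : Tendsto (fun k => ∫⁻ x, ‖φ (x + S (g k)) - φ (x + S g₀)‖ₑ ∂μ) atTop
          (𝓝 (∫⁻ _, 0 ∂μ)) := by
        refine tendsto_lintegral_of_dominated_convergence
          (fun _ => ENNReal.ofReal (‖φ‖ + ‖φ‖)) (fun k => by fun_prop) (fun k => ?_) (by simp)
          (ae_of_all _ fun x => ?_)
        · refine ae_of_all _ fun x => ?_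
          simp only
          rw [← ofReal_norm]
          exact ENNReal.ofReal_le_ofReal ((norm_sub_le _ _).trans
            (add_le_add (φ.norm_coe_le_norm _) (φ.norm_coe_le_norm _)))
        · have h1 : Tendsto (fun k => φ (x + S (g k)) - φ (x + S g₀)) atTop (𝓝 0) := by
            have := ((φ.continuous.tendsto (x + S g₀)).comp (hg.const_add x)).sub_const
              (φ (x + S g₀))
            simpa using this
          simpa using h1.enorm
      simpa using this
    have hε3 : 0 < ε / 3 := ENNReal.div_pos hε.ne' (by norm_num)
    filter_upwards [ENNReal.tendsto_nhds_zero.1 hlim _ hε3] with k hk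
    have hsplit : (fun x => u (x + S (g k)) - u (x + S g₀)) =
        ((fun x => (u - ⇑φ) (x + S (g k))) + fun x => φ (x + S (g k)) - φ (x + S g₀)) -
          fun x => (u - ⇑φ) (x + S g₀) := by
      funext x
      simp only [Pi.sub_apply, Pi.add_apply]
      ring
    have b1 := (hW.eLpNorm_comp_add_sqrt_le (hR k) hd).trans (mul_le_mul_right hφ K)
    have b2 := (hW.eLpNorm_comp_add_sqrt_le hR₀ hd).trans (mul_le_mul_right hφ K)
    have m1 : ∀ g, Measurable fun x => (u - ⇑φ) (x + S g) := fun g => by fun_prop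
    have m2 : Measurable fun x => φ (x + S (g k)) - φ (x + S g₀) := by fun_prop
    rw [hsplit]
    calc _ ≤ _ := eLpNorm_sub_le ((m1 _).add m2).aestronglyMeasurable
          (m1 g₀).aestronglyMeasurable le_rfl
      _ ≤ _ := add_le_add (eLpNorm_add_le (m1 _).aestronglyMeasurable m2.aestronglyMeasurable
          le_rfl) le_rfl
      _ ≤ (ε / 3 + ε / 3) + ε / 3 := by gcongr <;> [exact b1.trans hδε; exact b2.trans hδε]
      _ = ε := ENNReal.add_thirds ε
  have h := (ENNReal.tendsto_toReal ENNReal.zero_ne_top).comp key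
  refine h.congr fun k => ?_
  have mk : Measurable fun x => u (x + S (g k)) - u (x + S g₀) := by fun_prop
  rw [Function.comp, eLpNorm_one_eq_lintegral_enorm,
    ← integral_norm_eq_lintegral_enorm mk.aestronglyMeasurable]
  rfl

end Continuity

/-! ### Essential values and ergodicity on the base space -/

section BaseSpace

variable {H : Type*} [NormedAddCommGroup H] [InnerProductSpace ℝ H] [MeasurableSpace H]
  [BorelSpace H] [CompleteSpace H] [SecondCountableTopology H]
  {μ : Measure H} {S : H →L[ℝ] H} {W : H →L[ℝ] Lp ℝ 2 μ}

theorem gaussianReal_real_pos_of_isOpen {V : Set ℝ} (hV : IsOpen V) (hne : V.Nonempty) :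
    0 < (gaussianReal 0 1).real V := by
  have h : gaussianReal 0 1 V ≠ 0 := fun h0 =>
    (hV.measure_pos volume hne).ne' (gaussianReal_absolutelyContinuous' 0 one_ne_zero h0)
  exact ENNReal.toReal_pos h (measure_ne_top _ _)

/-- Translations along the image of an orthonormal sequence give every real number as an essential
value. For `k` large, `A` is almost invariant under the translation by `S (g k)`, while the cocycle
`-W (g k) - 1/2` has a fixed nondegenerate distribution and is almost independent of `A`. -/
theorem IsPaleyWiener.isEssentialValue [IsProbabilityMeasure μ] (hW : IsPaleyWiener μ S W)
    {g : ℕ → H} (hg : Orthonormal ℝ g) {Γ : Set (H ≃ᵐ H)}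
    (hΓ : ∀ k, translation (S (g k)) ∈ Γ) (a : ℝ) : IsEssentialValue μ Γ a := by
  intro A hA hpos U hU
  obtain ⟨V, hVU, hV, haV⟩ := mem_nhds_iff.1 hU
  set V' : Set ℝ := (fun y => -y - 1 / 2) ⁻¹' V with hV'
  have hV'o : IsOpen V' := hV.preimage (by fun_prop)
  have hc : 0 < (gaussianReal 0 1).real V' :=
    gaussianReal_real_pos_of_isOpen hV'o ⟨-a - 1 / 2, by simpa [hV'] using haV⟩
  set u : H → ℝ := A.indicator 1 with hu
  have mu : Measurable u := measurable_one.indicator hA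
  have hu1 : ∀ x, |u x| ≤ 1 := fun x => by
    by_cases hx : x ∈ A <;> simp [hu, hx]
  set η : ℝ → ℝ := V'.indicator 1 with hη
  have mη : Measurable η := measurable_one.indicator hV'o.measurableSet
  have hη1 : ∀ y, |η y| ≤ 1 := fun y => by
    by_cases hy : y ∈ V' <;> simp [hη, hy]
  have hμA : 0 < μ.real A := ENNReal.toReal_pos hpos.ne' (measure_ne_top _ _)
  have t1 := hW.tendsto_integral_mul_comp hg
    (MemLp.of_bound mu.aestronglyMeasurable 1 (ae_of_all _ hu1)) mη hη1
  rw [hu, hη, integral_indicator_one hA, integral_indicator_one hV'o.measurableSet, ← hu, ← hη]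
    at t1
  have t2 := hW.tendsto_integral_comp_add_sub (g := g) (g₀ := 0) (R := 1)
    (fun k => (hg.1 k).le) (by simp) (by simpa using hW.tendsto_sqrt_zero hg) mu hu1
  obtain ⟨k, hk⟩ := (t2.eventually_lt t1 (mul_pos hμA hc)).exists
  refine ⟨A ∩ translation (S (g k)) ⁻¹' A ∩ rnCocycle μ (translation (S (g k))) ⁻¹' V,
    fun x hx => hx.1.1, ?_, ?_, translation (S (g k)), hΓ k, ?_, fun y hy => hVU hy.2⟩
  · exact (hA.inter ((translation (S (g k))).measurable hA)).inter
      (measurable_rnCocycle _ _ hV.measurableSet)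
  · rw [pos_iff_ne_zero]
    intro h0
    have m := hW.measurable (g k)
    refine hk.not_ge (integral_mono_ae ?_ ?_ ?_)
    · refine Integrable.of_bound (mu.mul (mη.comp m)).aestronglyMeasurable 1
        (ae_of_all _ fun x => ?_)
      rw [norm_mul]
      exact mul_le_one₀ (hu1 _) (norm_nonneg _) (hη1 _)
    · have : Measurable fun x => |u (x + S (g k)) - u (x + S 0)| := by fun_prop
      refine Integrable.of_bound this.aestronglyMeasurable 2 (ae_of_all _ fun x => ?_)
      rw [Real.norm_eq_abs, abs_abs]
      exact (abs_sub _ _).trans (by linarith [hu1 (x + S (g k)), hu1 (x + S 0)])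
    · filter_upwards [measure_eq_zero_iff_ae_notMem.1 h0, hW.rnCocycle_eq (g k)] with x hx hρ
      by_cases hxA : x ∈ A
      · by_cases hxV : W (g k) x ∈ V'
        · have hxk : x + S (g k) ∉ A := fun hk => hx ⟨⟨hxA, hk⟩, by
            rw [Set.mem_preimage, hρ, hg.1 k]
            simpa [hV'] using hxV⟩
          simp [hu, hη, hxA, hxV, hxk]
        · simp [hη, hxV]
      · simp [hu, hxA]
  · rintro _ ⟨y, hy, rfl⟩
    exact hy.1.2

/-- A bounded function invariant under a Cameron-Martin dense group of translations is invariant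
under all Cameron-Martin translations. -/
theorem IsPaleyWiener.ae_eq_comp_add_sqrt [IsProbabilityMeasure μ] (hW : IsPaleyWiener μ S W)
    {G : AddSubgroup H} (hG : Dense (S ⁻¹' (G : Set H))) {u : H → ℝ} (mu : Measurable u) {M : ℝ}
    (hM : ∀ x, |u x| ≤ M) (hinv : ∀ f ∈ G, ∀ᵐ x ∂μ, u (x + f) = u x) (g : H) :
    ∀ᵐ x ∂μ, u (x + S g) = u x := by
  obtain ⟨s, hs, hlim⟩ := mem_closure_iff_seq_limit.1 (hG g)
  obtain ⟨R, hR⟩ := hlim.norm.bddAbove_range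
  have hR' : ∀ k, ‖s k‖ ≤ R := fun k => hR ⟨k, rfl⟩
  have t := hW.tendsto_integral_comp_add_sub (g := s) (g₀ := g) hR'
    (le_of_tendsto' hlim.norm hR') ((S.continuous.tendsto g).comp hlim) mu hM
  have e : ∀ k, ∫ x, |u (x + S (s k)) - u (x + S g)| ∂μ = ∫ x, |u x - u (x + S g)| ∂μ :=
    fun k => integral_congr_ae (by filter_upwards [hinv _ (hs k)] with x hx; rw [hx])
  simp only [e] at t
  have h0 := tendsto_nhds_unique tendsto_const_nhds t
  have m : Measurable fun x => |u x - u (x + S g)| := by fun_prop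
  rw [integral_eq_zero_iff_of_nonneg (fun x => abs_nonneg _)
    (Integrable.of_bound m.aestronglyMeasurable (M + M) (ae_of_all _ fun x => by
      rw [Real.norm_eq_abs, abs_abs]
      exact (abs_sub _ _).trans (add_le_add (hM _) (hM _))))] at h0
  filter_upwards [h0] with x hx
  exact (sub_eq_zero.1 (abs_eq_zero.1 hx)).symm

/-- A Cameron-Martin dense group of translations is ergodic. If `A` is invariant, the
Cameron-Martin formula shows that the moment generating functions of each `W g` under `μ` restricted
to `A` and under `μ A • μ` agree; so do then the characteristic functions of these two measures. -/
theorem IsPaleyWiener.measure_eq_zero_or_compl [IsProbabilityMeasure μ]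
    (hW : IsPaleyWiener μ S W) {G : AddSubgroup H} (hG : Dense (S ⁻¹' (G : Set H))) {A : Set H}
    (hA : MeasurableSet A) (hinv : ∀ f ∈ G, (fun x => x + f) ⁻¹' A =ᵐ[μ] A) :
    μ A = 0 ∨ μ Aᶜ = 0 := by
  rcases eq_or_ne (μ A) 0 with hA0 | hA0
  · exact Or.inl hA0
  right
  set u : H → ℝ := A.indicator 1 with hu
  have mu : Measurable u := measurable_one.indicator hA
  have hu1 : ∀ x, |u x| ≤ 1 := fun x => by
    by_cases hx : x ∈ A <;> simp [hu, hx]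
  have huinv : ∀ g, ∀ᵐ x ∂μ, u (x + S g) = u x := hW.ae_eq_comp_add_sqrt hG mu hu1 fun f hf => by
    filter_upwards [hinv f hf] with x hx
    have hx' : x + f ∈ A ↔ x ∈ A := iff_of_eq hx
    by_cases hxA : x ∈ A
    · simp [hu, hxA, hx'.2 hxA]
    · simp [hu, hxA, mt hx'.1 hxA]
  have hone : ∀ g, ∫ x in A, Real.exp (W g x) ∂μ = Real.exp (‖g‖ ^ 2 / 2) * μ.real A := fun g => by
    have h1 : ∫ x, u (x + S g) ∂μ = μ.real A := by
      rw [integral_congr_ae (huinv g), hu, integral_indicator_one hA]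
    have mg := hW.measurable g
    rw [← integral_map (f := u) (φ := fun x => x + S g) (by fun_prop) mu.aestronglyMeasurable,
      hW.map_add_sqrt, integral_withDensity_eq_integral_toReal_smul (by fun_prop) (by simp)] at h1
    rw [← h1, ← integral_const_mul, ← integral_indicator hA]
    refine integral_congr_ae (ae_of_all _ fun x => ?_)
    simp only
    rw [ENNReal.toReal_ofReal (Real.exp_pos _).le, Real.exp_sub, smul_eq_mul]
    by_cases hx : x ∈ A
    · simp [hu, hx]
      field_simp
    · simp [hu, hx]
  have hmgf : ∀ g, mgf (W g) (μ.restrict A) = mgf (W g) (μ A • μ) := fun g => by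
    funext r
    have h := hone (r • g)
    have e : (W (r • g) : H → ℝ) =ᵐ[μ] fun x => r * W g x := by
      rw [map_smul]; exact Lp.coeFn_smul r (W g)
    rw [integral_congr_ae (g := fun x => Real.exp (r * W g x))
      (ae_restrict_of_ae (by filter_upwards [e] with x hx; rw [hx]))] at h
    have h2 := mgf_gaussianReal (hW.map_eq g) r
    rw [mgf] at h2
    rw [mgf, mgf, h, integral_smul_measure, h2, smul_eq_mul, norm_smul, mul_pow,
      Real.norm_eq_abs, sq_abs, mul_comm]
    congr 2
    push_cast
    simp
    ring
  have hfin : IsFiniteMeasure (μ A • μ) := Measure.smul_finite μ (measure_ne_top _ _)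
  have heq : μ.restrict A = μ A • μ := by
    refine Measure.ext_of_charFun (funext fun y => ?_)
    have hexp : integrableExpSet (W (S y)) (μ.restrict A) = Set.univ :=
      Set.eq_univ_of_forall fun r => (hW.integrable_exp (S y) r).restrict
    have hne : μ.restrict A = 0 ↔ μ A • μ = 0 := by
      have hμ0 : μ ≠ 0 := IsProbabilityMeasure.ne_zero μ
      simp [Measure.restrict_eq_zero, hA0, hμ0]
    have h := eqOn_complexMGF_of_mgf' (hmgf (S y)) hne (x := Complex.I) (by simp [hexp])
    rw [complexMGF, complexMGF, integral_smul_measure] at h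
    have e : ∀ᵐ x ∂μ, Complex.exp (Complex.I * W (S y) x) =
        Complex.exp ((inner ℝ x y : ℝ) * Complex.I) := by
      filter_upwards [hW.apply_sqrt y] with x hx
      rw [hx, real_inner_comm, mul_comm]
    rw [integral_congr_ae (ae_restrict_of_ae e), integral_congr_ae e] at h
    rw [charFun_apply, charFun_apply, integral_smul_measure]
    exact h
  have h := congrArg (fun ν : Measure H => ν Aᶜ) heq
  simp only [Measure.restrict_apply hA.compl, Set.compl_inter_self, measure_empty,
    Measure.smul_apply, smul_eq_mul] at h
  exact (mul_eq_zero.1 h.symm).resolve_left hA0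

end BaseSpace

/-! ### Ergodicity of the Maharam extension -/

section RealLine

theorem abs_intervalIntegral_sub_le {f : ℝ → ℝ} (hf : Measurable f) (h1 : ∀ t, |f t| ≤ 1)
    (q a b : ℝ) : |(∫ t in a..a + q, f t) - ∫ t in b..b + q, f t| ≤ 2 * |a - b| := by
  have hi : ∀ a b, IntervalIntegrable f volume a b := fun a b =>
    (intervalIntegrable_const (c := (1 : ℝ))).mono_fun hf.aestronglyMeasurable
      (ae_of_all _ fun t => by simpa using h1 t)
  have hle : ∀ a b, |∫ t in a..b, f t| ≤ |b - a| := fun a b => by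
    simpa using intervalIntegral.norm_integral_le_of_norm_le_const (C := 1) (a := a) (b := b)
      (f := f) fun t _ => h1 t
  rw [intervalIntegral.integral_interval_sub_interval_comm (hi _ _) (hi _ _) (hi _ _)]
  have e1 := hle a b
  have e2 := hle (a + q) (b + q)
  rw [add_sub_add_right_eq_sub] at e2
  rw [abs_sub_comm a b]
  exact (abs_sub _ _).trans (by linarith)

/-- A set of reals whose measure in intervals does not change under rational translations is null or
conull: Lebesgue measure restricted to it is translation invariant, hence a multiple of Lebesgue
measure. -/
theorem volume_eq_zero_or_compl_of_intervalIntegral {E : Set ℝ} (hE : MeasurableSet E)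
    (h : ∀ q a : ℚ, ∫ t in (0 : ℝ)..0 + q, E.indicator (1 : ℝ → ℝ) t =
      ∫ t in (a : ℝ)..a + q, E.indicator (1 : ℝ → ℝ) t) :
    volume E = 0 ∨ volume Eᶜ = 0 := by
  set F : ℝ → ℝ := E.indicator 1 with hF
  have mF : Measurable F := measurable_one.indicator hE
  have hF1 : ∀ t, ‖F t‖ ≤ ‖(1 : ℝ)‖ := fun t => by
    by_cases ht : t ∈ E <;> simp [hF, ht]
  have hi : ∀ a b, IntervalIntegrable F volume a b := fun a b =>
    (intervalIntegrable_const (c := (1 : ℝ))).mono_fun mF.aestronglyMeasurable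
      (ae_of_all _ hF1)
  set φ : ℝ → ℝ := fun r => ∫ t in (0 : ℝ)..r, F t with hφ
  have hφc : Continuous φ := intervalIntegral.continuous_primitive hi 0
  have hsub : ∀ a b, ∫ t in a..b, F t = φ b - φ a := fun a b =>
    (intervalIntegral.integral_interval_sub_left (hi _ _) (hi _ _)).symm
  have hadd : ∀ p : ℝ × ℝ, φ p.1 = φ (p.2 + p.1) - φ p.2 := by
    have hd : DenseRange (Prod.map ((↑) : ℚ → ℝ) ((↑) : ℚ → ℝ)) :=
      Rat.denseRange_cast.prodMap Rat.denseRange_cast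
    refine congrFun (hd.equalizer (by fun_prop) (by fun_prop) (funext fun p => ?_))
    have := h p.1 p.2
    rw [hsub, hsub] at this
    simpa [hφ] using this
  set m := (volume : Measure ℝ).restrict E with hm
  have hm_Ioc : ∀ a b, a < b → m (Set.Ioc a b) = ENNReal.ofReal (φ b - φ a) := fun a b hab => by
    rw [← hsub, intervalIntegral.integral_of_le hab.le, hF, integral_indicator_one hE,
      Measure.real, ENNReal.ofReal_toReal (by
        rw [Measure.restrict_apply hE]
        exact ((measure_mono Set.inter_subset_right).trans_lt measure_Ioc_lt_top).ne),
      hm, Measure.restrict_apply measurableSet_Ioc, Measure.restrict_apply hE, Set.inter_comm]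
  have hinv : m.IsAddLeftInvariant := ⟨fun g => by
    symm
    refine Measure.ext_of_Ioc _ _ fun a b hab => ?_
    rw [Measure.map_apply (by fun_prop) measurableSet_Ioc, Set.preimage_const_add_Ioc,
      hm_Ioc a b hab, hm_Ioc _ _ (by linarith)]
    have e1 := hadd (g, a - g)
    have e2 := hadd (g, b - g)
    simp only [sub_add_cancel] at e1 e2
    congr 1
    linarith⟩
  have hsmul := Measure.isAddLeftInvariant_eq_smul m (volume : Measure ℝ)
  have h0 : m Eᶜ = 0 := by
    rw [hm, Measure.restrict_apply hE.compl, Set.compl_inter_self, measure_empty]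
  rcases eq_or_ne (Measure.addHaarScalarFactor m (volume : Measure ℝ)) 0 with hc | hc
  · left
    rw [hc, zero_smul] at hsmul
    exact Measure.restrict_eq_zero.1 hsmul
  · right
    rw [hsmul, Measure.smul_apply] at h0
    exact (smul_eq_zero.1 h0).resolve_left hc

end RealLine

section Sections

variable {X : Type*}

/-- The measure of the section `{t | (x, t) ∈ A}` in the interval from `a` to `a + q`, counted
negatively if `q < 0`. -/
noncomputable def sectionMass (A : Set (X × ℝ)) (q : ℝ) (x : X) (a : ℝ) : ℝ :=
  ∫ t in a..a + q, A.indicator (1 : X × ℝ → ℝ) (x, t)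

theorem abs_indicator_one_le {Z : Type*} (A : Set Z) (z : Z) :
    |A.indicator (1 : Z → ℝ) z| ≤ 1 := by
  by_cases h : z ∈ A <;> simp [h]

theorem abs_sectionMass_le (A : Set (X × ℝ)) (q : ℝ) (x : X) (a : ℝ) :
    |sectionMass A q x a| ≤ |q| := by
  have := intervalIntegral.norm_integral_le_of_norm_le_const (C := 1) (a := a) (b := a + q)
    (f := fun t => A.indicator (1 : X × ℝ → ℝ) (x, t)) fun t _ => abs_indicator_one_le A _
  simpa [sectionMass] using this

variable [MeasurableSpace X]

theorem measurable_sectionMass {A : Set (X × ℝ)} (hA : MeasurableSet A) (q a : ℝ) :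
    Measurable fun x => sectionMass A q x a := by
  have h : StronglyMeasurable (A.indicator (1 : X × ℝ → ℝ)) :=
    stronglyMeasurable_one.indicator hA
  simp only [sectionMass, intervalIntegral]
  exact (h.integral_prod_right'.measurable).sub (h.integral_prod_right'.measurable)

theorem measurable_indicator_section {A : Set (X × ℝ)} (hA : MeasurableSet A) (x : X) :
    Measurable fun t : ℝ => A.indicator (1 : X × ℝ → ℝ) (x, t) :=
  (measurable_one.indicator hA).comp measurable_prodMk_left

theorem abs_sectionMass_sub_le {A : Set (X × ℝ)} (hA : MeasurableSet A) (q : ℝ) (x : X)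
    (a b : ℝ) : |sectionMass A q x a - sectionMass A q x b| ≤ 2 * |a - b| :=
  abs_intervalIntegral_sub_le (measurable_indicator_section hA x)
    (fun _ => abs_indicator_one_le A _) q a b

end Sections

section Maharam

variable {H : Type*} [NormedAddCommGroup H] [MeasurableSpace H]
  [BorelSpace H] {μ : Measure H}

/-- Invariance under the Maharam extension of a translation, section by section. -/
theorem ae_section_of_invariant [SFinite μ] {A : Set (H × ℝ)} {f : H}
    (hinv : maharamMap μ (translation f) ⁻¹' A =ᵐ[μ.prod volume] A) :
    ∀ᵐ x ∂μ, ∀ᵐ t : ℝ, (x + f, rnCocycle μ (translation f) x + t) ∈ A ↔ (x, t) ∈ A := by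
  have h : ∀ᵐ p ∂μ.prod volume, (p.1 + f, rnCocycle μ (translation f) p.1 + p.2) ∈ A ↔ p ∈ A := by
    filter_upwards [hinv] with p hp
    exact iff_of_eq hp
  exact Measure.ae_ae_of_ae_prod h

theorem sectionMass_eq_of_invariant [SFinite μ] {A : Set (H × ℝ)} {f : H}
    (hinv : maharamMap μ (translation f) ⁻¹' A =ᵐ[μ.prod volume] A) (q : ℝ) :
    ∀ᵐ x ∂μ, sectionMass A q x 0 =
      sectionMass A q (x + f) (rnCocycle μ (translation f) x) := by
  filter_upwards [ae_section_of_invariant hinv] with x hx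
  set ρ := rnCocycle μ (translation f) x
  have e := intervalIntegral.integral_comp_add_left (a := 0) (b := 0 + q)
    (fun t => A.indicator (1 : H × ℝ → ℝ) (x + f, t)) ρ
  rw [add_zero, zero_add] at e
  rw [sectionMass, sectionMass, zero_add, ← e]
  refine intervalIntegral.integral_congr_ae ?_
  filter_upwards [hx] with t ht _
  by_cases hA : (x, t) ∈ A
  · simp [hA, ht.2 hA]
  · simp [hA, mt ht.1 hA]

variable [InnerProductSpace ℝ H] [CompleteSpace H] [SecondCountableTopology H]
  {S : H →L[ℝ] H} {W : H →L[ℝ] Lp ℝ 2 μ}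

/-- Almost every section of a set invariant under the Maharam extension has the same mass in an
interval and in its translate by `a`. Take `S (g k) ∈ G` with `g k` close to the `k`-th vector of
an orthonormal sequence `o`. On the event `|-W (o k) - 1/2 - a| < δ` the cocycle is within about `δ`
of `a`, the sections over `x + S (g k)` and over `x` have nearly the same mass, and the event is
asymptotically independent of `x`. -/
theorem IsPaleyWiener.sectionMass_eq [IsProbabilityMeasure μ] (hW : IsPaleyWiener μ S W)
    {o : ℕ → H} (ho : Orthonormal ℝ o) {G : AddSubgroup H} (hG : Dense (S ⁻¹' (G : Set H)))
    {A : Set (H × ℝ)} (hA : MeasurableSet A)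
    (hinv : ∀ f ∈ G, maharamMap μ (translation f) ⁻¹' A =ᵐ[μ.prod volume] A) (q a : ℝ) :
    ∀ᵐ x ∂μ, sectionMass A q x 0 = sectionMass A q x a := by
  choose g hgG hgo using fun k : ℕ =>
    hG.exists_dist_lt (o k) (ε := 1 / ((k : ℝ) + 1)) Nat.one_div_pos_of_nat
  have hdist : Tendsto (fun k => ‖o k - g k‖) atTop (𝓝 0) :=
    squeeze_zero (fun _ => norm_nonneg _) (fun k => by rw [← dist_eq_norm]; exact (hgo k).le)
      tendsto_one_div_add_atTop_nhds_zero_nat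
  have hog : Tendsto (fun k => o k - g k) atTop (𝓝 0) := tendsto_zero_iff_norm_tendsto_zero.2 hdist
  have hnorm : Tendsto (fun k => ‖g k‖) atTop (𝓝 1) := by
    have h : Tendsto (fun k => ‖g k‖ - ‖o k‖) atTop (𝓝 0) :=
      squeeze_zero_norm (fun k => (abs_norm_sub_norm_le _ _).trans_eq (norm_sub_rev _ _)) hdist
    have h2 := h.add_const 1
    simpa [ho.1] using h2
  obtain ⟨R, hR⟩ := hnorm.bddAbove_range
  have hR' : ∀ k, ‖g k‖ ≤ R := fun k => hR ⟨k, rfl⟩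
  have hSg : Tendsto (fun k => S (g k)) atTop (𝓝 (S 0)) := by
    have h := (hW.tendsto_sqrt_zero ho).sub ((S.continuous.tendsto 0).comp hog)
    simpa [Function.comp_def] using h
  set u : H → ℝ := fun x => sectionMass A q x a with hu
  have mu : Measurable u := measurable_sectionMass hA q a
  have hu1 : ∀ x, |u x| ≤ |q| := fun x => abs_sectionMass_le A q x a
  set v : H → ℝ := fun x => |sectionMass A q x 0 - sectionMass A q x a| with hv
  have mv : Measurable v :=
    measurable_norm.comp ((measurable_sectionMass hA q 0).sub (measurable_sectionMass hA q a))
  have hv1 : ∀ x, ‖v x‖ ≤ |q| + |q| := fun x => by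
    rw [hv, Real.norm_eq_abs, abs_abs]
    exact (abs_sub _ _).trans (add_le_add (abs_sectionMass_le _ _ _ _) (abs_sectionMass_le _ _ _ _))
  have hvi : Integrable v μ := Integrable.of_bound mv.aestronglyMeasurable _ (ae_of_all _ hv1)
  have t2 := hW.tendsto_integral_comp_add_sub (g := g) (g₀ := 0) hR'
    (by simpa using (norm_nonneg _).trans (hR' 0)) hSg mu hu1
  simp only [map_zero, add_zero] at t2
  have hle : ∀ δ : ℝ, 0 < δ → ∫ x, v x ∂μ ≤ 2 * δ := by
    intro δ hδ
    set V : Set ℝ := {y | |-y - 1 / 2 - a| < δ} with hV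
    have hVo : IsOpen V := isOpen_lt (by fun_prop) (by fun_prop)
    have hc : 0 < (gaussianReal 0 1).real V :=
      gaussianReal_real_pos_of_isOpen hVo ⟨-a - 1 / 2, by
        have : -(-a - 1 / 2) - 1 / 2 - a = 0 := by ring
        rw [hV, Set.mem_ofPred_eq, this, abs_zero]
        exact hδ⟩
    set η : ℝ → ℝ := V.indicator 1 with hη
    have mη : Measurable η := measurable_one.indicator hVo.measurableSet
    have hη1 : ∀ y, |η y| ≤ 1 := abs_indicator_one_le V
    have t1 := hW.tendsto_integral_mul_comp ho
      (MemLp.of_bound mv.aestronglyMeasurable _ (ae_of_all _ hv1)) mη hη1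
    have t3 := hW.tendsto_integral_mul_comp ho (memLp_const (1 : ℝ)) mη hη1
    rw [hη, integral_indicator_one hVo.measurableSet, ← hη] at t1 t3
    simp only [one_mul, integral_const, probReal_univ, smul_eq_mul] at t3
    have t4 : Tendsto (fun k => ‖W (o k - g k)‖) atTop (𝓝 0) := by
      have := ((W.continuous.tendsto 0).comp hog).norm
      simpa [Function.comp_def] using this
    have t5 : Tendsto (fun k => |1 - ‖g k‖ ^ 2|) atTop (𝓝 0) := by
      have := ((hnorm.pow 2).const_sub 1).abs
      simpa using this
    have tsum := ((t2.add (t3.const_mul (2 * δ))).add (t4.const_mul 2)).add t5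
    simp only [zero_add, mul_zero, add_zero] at tsum
    have hlim := le_of_tendsto_of_tendsto' t1 tsum fun k => ?_
    · exact le_of_mul_le_mul_right hlim hc
    have mo := hW.measurable (o k)
    have mηk : Measurable fun x => η (W (o k) x) := mη.comp mo
    have i1 : Integrable (fun x => |u (x + S (g k)) - u x|) μ := by
      have m : Measurable fun x => |u (x + S (g k)) - u x| := by fun_prop
      refine Integrable.of_bound m.aestronglyMeasurable (|q| + |q|) (ae_of_all _ fun x => ?_)
      rw [Real.norm_eq_abs, abs_abs]
      exact (abs_sub _ _).trans (add_le_add (hu1 _) (hu1 _))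
    have i2 : Integrable (fun x => 2 * δ * η (W (o k) x)) μ :=
      (Integrable.of_bound mηk.aestronglyMeasurable 1 (ae_of_all _ fun x => hη1 _)).const_mul _
    have i3 : Integrable (fun x => 2 * |W (o k - g k) x|) μ :=
      (integrable_Lp (W (o k - g k))).abs.const_mul 2
    have i12 : Integrable (fun x => |u (x + S (g k)) - u x| + 2 * δ * η (W (o k) x)) μ := i1.add i2
    have i123 : Integrable (fun x => (|u (x + S (g k)) - u x| + 2 * δ * η (W (o k) x)) +
        2 * |W (o k - g k) x|) μ := i12.add i3
    calc ∫ x, v x * η (W (o k) x) ∂μ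
        ≤ ∫ x, ((|u (x + S (g k)) - u x| + 2 * δ * η (W (o k) x)) + 2 * |W (o k - g k) x|) +
            |1 - ‖g k‖ ^ 2| ∂μ := by
          refine integral_mono_ae (hvi.mul_bdd (c := 1) mηk.aestronglyMeasurable
            (ae_of_all _ fun x => hη1 _)) (i123.add (integrable_const _)) ?_
          have hsub : (W (o k - g k) : H → ℝ) =ᵐ[μ] fun x => W (o k) x - W (g k) x := by
            rw [map_sub]; exact Lp.coeFn_sub _ _
          filter_upwards [sectionMass_eq_of_invariant (hinv _ (hgG k)) q, hW.rnCocycle_eq (g k),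
            hsub] with x hx hρ hsub
          simp only [hv, hu]
          rw [hsub]
          by_cases hy : W (o k) x ∈ V
          · have hη' : η (W (o k) x) = 1 := by simp [hη, hy]
            have hy' : |-W (o k) x - 1 / 2 - a| < δ := hy
            have hlip := abs_sectionMass_sub_le hA q (x + S (g k)) (-W (g k) x - ‖g k‖ ^ 2 / 2) a
            rw [hη', mul_one, mul_one, hx, hρ]
            have tri := abs_sub_le (sectionMass A q (x + S (g k)) (-W (g k) x - ‖g k‖ ^ 2 / 2))
              (sectionMass A q (x + S (g k)) a) (sectionMass A q x a)
            have e : -W (g k) x - ‖g k‖ ^ 2 / 2 - a = ((-W (o k) x - 1 / 2 - a) +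
                (W (o k) x - W (g k) x)) + (1 - ‖g k‖ ^ 2) / 2 := by ring
            have b : |-W (g k) x - ‖g k‖ ^ 2 / 2 - a| ≤ |-W (o k) x - 1 / 2 - a| +
                |W (o k) x - W (g k) x| + |1 - ‖g k‖ ^ 2| / 2 := by
              rw [e]
              refine (abs_add_le _ _).trans (add_le_add (abs_add_le _ _) ?_)
              rw [abs_div, abs_two]
            linarith
          · have hη' : η (W (o k) x) = 0 := by simp [hη, hy]
            rw [hη']
            simp only [mul_zero, add_zero]
            positivity
      _ = ∫ x, |u (x + S (g k)) - u x| ∂μ + 2 * δ * ∫ x, η (W (o k) x) ∂μ +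
            2 * ∫ x, |W (o k - g k) x| ∂μ + |1 - ‖g k‖ ^ 2| := by
          rw [integral_add i123 (integrable_const _), integral_add i12 i3,
            integral_add i1 i2, integral_const_mul, integral_const_mul, integral_const]
          simp
      _ ≤ _ := by
          have := integral_abs_Lp_le (W (o k - g k))
          linarith
  have h0 : ∫ x, v x ∂μ = 0 := by
    refine le_antisymm (le_of_forall_pos_le_add fun ε hε => ?_)
      (integral_nonneg fun x => abs_nonneg _)
    have := hle (ε / 2) (by positivity)
    linarith
  rw [integral_eq_zero_iff_of_nonneg (fun x => abs_nonneg _) hvi] at h0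
  filter_upwards [h0] with x hx
  exact sub_eq_zero.1 (abs_eq_zero.1 hx)

/-- The Maharam extension of a Cameron-Martin dense group of translations is ergodic. -/
theorem IsPaleyWiener.maharam_measure_eq_zero_or_compl [IsProbabilityMeasure μ]
    (hW : IsPaleyWiener μ S W) (hdim : ¬ FiniteDimensional ℝ H) {G : AddSubgroup H}
    (hG : Dense (S ⁻¹' (G : Set H))) {A : Set (H × ℝ)} (hA : MeasurableSet A)
    (hinv : ∀ f ∈ G, maharamMap μ (translation f) ⁻¹' A =ᵐ[μ.prod volume] A) :
    (μ.prod volume) A = 0 ∨ (μ.prod volume) Aᶜ = 0 := by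
  obtain ⟨o, ho⟩ := exists_orthonormal_nat hdim
  have hsec : ∀ᵐ x ∂μ, volume (Prod.mk x ⁻¹' A) = 0 ∨ volume (Prod.mk x ⁻¹' A)ᶜ = 0 := by
    have h : ∀ᵐ x ∂μ, ∀ q a : ℚ, sectionMass A q x 0 = sectionMass A q x a :=
      ae_all_iff.2 fun q => ae_all_iff.2 fun a => hW.sectionMass_eq ho hG hA hinv q a
    filter_upwards [h] with x hx
    exact volume_eq_zero_or_compl_of_intervalIntegral (measurable_prodMk_left hA) hx
  set A₀ : Set H := {x | volume (Prod.mk x ⁻¹' A)ᶜ = 0} with hA₀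
  have mA₀ : MeasurableSet A₀ :=
    measurable_measure_prodMk_left hA.compl (measurableSet_singleton 0)
  have hinv₀ : ∀ f ∈ G, (fun x => x + f) ⁻¹' A₀ =ᵐ[μ] A₀ := fun f hf => by
    filter_upwards [ae_section_of_invariant (hinv f hf)] with x hx
    have e : volume (Prod.mk (x + f) ⁻¹' A)ᶜ = volume (Prod.mk x ⁻¹' A)ᶜ := by
      rw [← measure_preimage_add volume (rnCocycle μ (translation f) x)
        (Prod.mk (x + f) ⁻¹' A)ᶜ]
      refine measure_congr ?_
      filter_upwards [hx] with t ht
      exact propext (not_congr ht)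
    change (volume (Prod.mk (x + f) ⁻¹' A)ᶜ = 0) = (volume (Prod.mk x ⁻¹' A)ᶜ = 0)
    rw [e]
  rcases hW.measure_eq_zero_or_compl hG mA₀ hinv₀ with h0 | h0
  · left
    rw [Measure.measure_prod_null hA]
    filter_upwards [hsec, measure_eq_zero_iff_ae_notMem.1 h0] with x h1 h2
    exact h1.resolve_right h2
  · right
    rw [Measure.measure_prod_null hA.compl]
    filter_upwards [measure_eq_zero_iff_ae_notMem.1 h0] with x hx
    exact not_not.1 hx

end Maharam

/-! ### Krieger type and the square root of the covariance -/

section Krieger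

variable {H : Type*} [NormedAddCommGroup H] [InnerProductSpace ℝ H] [MeasurableSpace H]
  [BorelSpace H] [CompleteSpace H]

theorem IsPaleyWiener.isKriegerTypeIIIOne [SecondCountableTopology H] {μ : Measure H}
    {S : H →L[ℝ] H} {W : H →L[ℝ] Lp ℝ 2 μ} [IsProbabilityMeasure μ] (hW : IsPaleyWiener μ S W)
    (hdim : ¬ FiniteDimensional ℝ H) {G : AddSubgroup H} (hle : ∀ f ∈ G, ∃ g, S g = f)
    (hG : Dense (S ⁻¹' (G : Set H))) : IsKriegerTypeIIIOne μ (translations G) where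
  nonsingular := by
    rintro _ ⟨f, hf, rfl⟩
    obtain ⟨g, rfl⟩ := hle f hf
    exact hW.nonsingular g
  ergodic A hA hinv := hW.measure_eq_zero_or_compl hG hA fun f hf =>
    hinv _ ⟨translation f, ⟨f, hf, rfl⟩, rfl⟩
  maharam_ergodic A hA hinv := hW.maharam_measure_eq_zero_or_compl hdim hG hA fun f hf =>
    hinv _ ⟨translation f, ⟨f, hf, rfl⟩, rfl⟩

end Krieger

section SquareRoot

variable {H : Type*} [NormedAddCommGroup H] [InnerProductSpace ℝ H] [CompleteSpace H]
  {B : H →L[ℝ] H}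

theorem sqrtOp_apply_apply (hB : StrictlyPositive B) (x : H) : sqrtOp B (sqrtOp B x) = B x :=
  congrArg (fun T : H →L[ℝ] H => T x) (sqrtOp_mul_self hB.1)

theorem inner_sqrtOp (hB : StrictlyPositive B) (x y : H) :
    inner ℝ (sqrtOp B x) y = inner ℝ x (sqrtOp B y) :=
  (sqrtOp_isPositive hB.1).isSymmetric x y

theorem inner_sqrtOp_sqrtOp (hB : StrictlyPositive B) (x y : H) :
    inner ℝ (sqrtOp B x) (sqrtOp B y) = inner ℝ (B x) y := by
  rw [← inner_sqrtOp hB, sqrtOp_apply_apply hB]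

theorem eq_zero_of_sqrtOp_eq_zero (hB : StrictlyPositive B) (x : H) (hx : sqrtOp B x = 0) :
    x = 0 := by
  by_contra h
  have := hB.2 x h
  rw [← inner_sqrtOp_sqrtOp hB, hx, inner_zero_left] at this
  exact lt_irrefl _ this

theorem cameronMartinNorm_sqrtOp (hB : StrictlyPositive B) (g : H) :
    cameronMartinNorm B (sqrtOp B g) = ‖g‖ := by
  have hinj : Function.Injective (sqrtOp B) :=
    (injective_iff_map_eq_zero (sqrtOp B)).2 (eq_zero_of_sqrtOp_eq_zero hB)
  rw [cameronMartinNorm, Function.leftInverse_invFun hinj g]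

theorem IsCountableDense.dense_preimage (hB : StrictlyPositive B) {G : AddSubgroup H}
    (hG : IsCountableDense B G) : Dense (sqrtOp B ⁻¹' (G : Set H)) := by
  refine Metric.dense_iff.2 fun g ε hε => ?_
  obtain ⟨f, hf, hlt⟩ := hG.dense (sqrtOp B g) ⟨g, rfl⟩ ε hε
  obtain ⟨g', rfl⟩ : ∃ g', sqrtOp B g' = f := hG.le hf
  rw [← map_sub, cameronMartinNorm_sqrtOp hB, ← dist_eq_norm, dist_comm] at hlt
  exact ⟨g', hlt, hf⟩

theorem exists_isCountableDense [TopologicalSpace.SeparableSpace H] (hB : StrictlyPositive B) :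
    ∃ G : AddSubgroup H, IsCountableDense B G := by
  set L : (ℕ →₀ ℤ) →ₗ[ℤ] H :=
    Finsupp.linearCombination ℤ fun n => sqrtOp B (TopologicalSpace.denseSeq H n) with hL
  refine ⟨L.toAddMonoidHom.range, ⟨Set.countable_range L, ?_, ?_⟩⟩
  · rintro _ ⟨c, rfl⟩
    refine Submodule.sum_mem _ fun n _ => ?_
    exact (cameronMartin B).toAddSubgroup.zsmul_mem ⟨TopologicalSpace.denseSeq H n, rfl⟩ (c n)
  · rintro _ ⟨g, rfl⟩ ε hε
    obtain ⟨n, hn⟩ :=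
      (TopologicalSpace.denseRange_denseSeq H).exists_dist_lt g hε
    refine ⟨sqrtOp B (TopologicalSpace.denseSeq H n), ⟨Finsupp.single n 1, ?_⟩, ?_⟩
    · change L _ = _
      rw [hL, Finsupp.linearCombination_single, one_smul]
    · rw [ContinuousLinearMap.coe_coe, ← map_sub, cameronMartinNorm_sqrtOp hB, ← dist_eq_norm]
      exact hn

/-- Normalized eigenvectors are images under `B^{1/2}` of an orthonormal sequence. -/
theorem exists_orthonormal_sqrtOp_eq (hB : StrictlyPositive B) {e : ℕ → H} (he : Orthonormal ℝ e)
    {lam : ℕ → ℝ} (hlam : ∀ k, B (e k) = lam k • e k) :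
    ∃ g : ℕ → H, Orthonormal ℝ g ∧ ∀ k, sqrtOp B (g k) = Real.sqrt (lam k) • e k := by
  have hpos : ∀ k, 0 < lam k := fun k => by
    have h := hB.2 (e k) (he.ne_zero k)
    rwa [hlam, inner_smul_left, real_inner_self_eq_norm_sq, he.1 k, one_pow, mul_one] at h
  have hne : ∀ k, Real.sqrt (lam k) ≠ 0 := fun k => (Real.sqrt_pos.2 (hpos k)).ne'
  have hsq : ∀ k, (Real.sqrt (lam k))⁻¹ * lam k = Real.sqrt (lam k) := fun k => by
    rw [inv_mul_eq_div, Real.div_sqrt]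
  refine ⟨fun k => (Real.sqrt (lam k))⁻¹ • sqrtOp B (e k), ?_, fun k => ?_⟩
  · rw [orthonormal_iff_ite] at he ⊢
    intro j k
    rw [inner_smul_left, inner_smul_right, inner_sqrtOp_sqrtOp hB, hlam, inner_smul_left, he]
    split_ifs with hjk
    · subst hjk
      simp only [conj_trivial, mul_one]
      rw [hsq, inv_mul_cancel₀ (hne j)]
    · simp
  · rw [map_smul, sqrtOp_apply_apply hB, hlam, smul_smul, hsq]

end SquareRoot

end GaussianTranslations

open GaussianTranslations in
theorem theorem3p7 {H : Type*} [NormedAddCommGroup H] [InnerProductSpace ℝ H] [CompleteSpace H]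
    [TopologicalSpace.SeparableSpace H] [MeasurableSpace H] [BorelSpace H]
    (hdim : ¬ FiniteDimensional ℝ H)
    (B : H →L[ℝ] H) (hB : StrictlyPositive B)
    (μ : Measure H) (hμ : IsCenteredGaussian μ B) :
    IsKriegerTypeIIIOne μ (translations (cameronMartin B).toAddSubgroup) ∧
    (∃ G : AddSubgroup H, IsCountableDense B G) ∧
    (∀ G : AddSubgroup H, IsCountableDense B G → IsKriegerTypeIIIOne μ (translations G)) ∧
    (∀ (e : HilbertBasis ℕ ℝ H) (lam : ℕ → ℝ), (∀ k, B (e k) = lam k • e k) →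
      (∀ k, Real.sqrt (lam k) • e k ∈ cameronMartin B) ∧
      ∀ a : ℝ, IsEssentialValue μ
        (translations (AddSubgroup.closure (Set.range fun k => Real.sqrt (lam k) • e k))) a) := by
  have := hμ.1
  have := UniformSpace.secondCountable_of_separable H
  have hchar : ∀ y, charFun μ y = Complex.exp (-(‖sqrtOp B y‖ ^ 2 / 2 : ℝ)) := fun y => by
    rw [hμ.2 y, ← inner_sqrtOp_sqrtOp hB, real_inner_self_eq_norm_sq]
    congr 1
    push_cast
    ring
  obtain ⟨W, hW⟩ := exists_isPaleyWiener hchar (inner_sqrtOp hB) (eq_zero_of_sqrtOp_eq_zero hB)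
  refine ⟨hW.isKriegerTypeIIIOne hdim (fun f hf => hf) ?_, exists_isCountableDense hB,
    fun G hG => hW.isKriegerTypeIIIOne hdim (fun f hf => hG.le hf) (hG.dense_preimage hB),
    fun e lam hlam => ?_⟩
  · exact dense_univ.mono fun g _ => ⟨g, rfl⟩
  · obtain ⟨g, hg, hgk⟩ := exists_orthonormal_sqrtOp_eq hB e.orthonormal hlam
    refine ⟨fun k => ⟨g k, hgk k⟩, hW.isEssentialValue hg fun k => ?_⟩
    rw [hgk]
    exact ⟨_, AddSubgroup.subset_closure ⟨k, rfl⟩, rfl⟩
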